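/- **Setting.** A weighted Holant instance $\Omega$ consists of a finite graph $G=(V,E)$ (parallel edges and loops are allowed, a loop counts twice in the degree), for every vertex $v$ of degree $d_v$ a symmetric function $[f_0,\dots,f_{d_v}]$ with values in the non-negative reals ($f_j$ is the value $F_v$ takes on inputs of Hamming weight $j$), and for every edge $e$ a real weight $\lambda_e$. Its partition function is $$Z(\Omega)=\sum_{\sigma:E\to\{0,1\}}\ \prod_{e\in E}\lambda_e^{\sigma(e)}\prod_{v\in V}F_v(\sigma|_{E(v)}),$$ where $E(v)$ denotes the edges incident with $v$. For $c,p,q\in\mathbb R$ let $\mathcal F_c^{p,q}$ be the set of all symmetric functions $[f_0,\dots,f_d]$, of any arity $d\ge 0$, with non-negative values such that $f_{i+2}=cf_{i+1}+f_i$ for $0\le i\le d-2$ and $p f_i\le f_{i+1}\le q f_i$ for $0\le i\le d-1$. Let $\Lambda_{\lambda,+\infty}=[\lambda,+\infty)$. The problem $\mathrm{Holant}(\mathcal F,\Lambda)$ asks for $Z(\Omega)$, given an instance $\Omega$ all of whose vertex functions lie in $\mathcal F$ and all of whose edge weights lie in $\Lambda$. A fully polynomial-time approximation scheme (FPTAS)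 for $\mathrm{Holant}(\mathcal F,\Lambda)$ is a deterministic algorithm that, given an instance $\Omega$ and $\varepsilon>0$, outputs a number $Z'$ with $(1-\varepsilon)Z(\Omega)<Z'<(1+\varepsilon)Z(\Omega)$ (and $Z'=0$ if $Z(\Omega)=0$) and runs in time polynomial in $|V|+|E|$ and $1/\varepsilon$. Here the algorithm is one program with rational constants that works with exact real numbers, each field operation or comparison being one step; moreover, if all numbers in the input are rational, the bit cost of the same program is polynomial in the bit length of the input and $1/\varepsilon$. **Theorem.** Let $\lambda>0$ and $c\ge 2.57$ be real numbers. Then there is an FPTAS for $\mathrm{Holant}\bigl(\mathcal F_c^{c/2,\,c+2/c},\ \Lambda_{\lambda,+\infty}\bigr)$. -/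

import Mathlib

/-!
Weighted Holant problems with symmetric signatures, Fibonacci signatures, a programming language
with an explicit cost semantics, and fully polynomial-time approximation schemes.
-/

/-! ### Weighted Holant instances -/

/-- The number of ends of an edge with end points `p` that lie at the vertex `v`
(`2` for a loop at `v`). -/
def endsAt {n : ℕ} (p : Fin n × Fin n) (v : Fin n) : ℕ :=
  (if p.1 = v then 1 else 0) + (if p.2 = v then 1 else 0)

/-- A weighted Holant instance with symmetric vertex functions. The graph has vertex set `Fin n` and
edges indexed by `Fin m`; parallel edges and loops are allowed. The function at `v` is given by
`sig v = [f_0, …, f_d]`, where `d` is the degree of `v` and `f_j` is the value on inputs of Hamming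
weight `j`. Edge weights are normalized: the weight of the edge `e` is `1` if `e` is not chosen and
`weight e` if it is. -/
structure HolantInstance where
  n : ℕ
  m : ℕ
  ends : Fin m → Fin n × Fin n
  weight : Fin m → ℝ
  sig : Fin n → List ℝ
  sig_length : ∀ v, (sig v).length = (∑ e, endsAt (ends e) v) + 1

namespace HolantInstance

/-- The Hamming weight of the restriction of `σ` to the edges incident with `v`. -/
def load (Ω : HolantInstance) (σ : Fin Ω.m → Bool) (v : Fin Ω.n) : ℕ :=
  ∑ e, if σ e then endsAt (Ω.ends e) v else 0

theorem load_lt_length (Ω : HolantInstance) (σ : Fin Ω.m → Bool) (v : Fin Ω.n) :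
    Ω.load σ v < (Ω.sig v).length := by
  rw [Ω.sig_length v]
  refine Nat.lt_succ_of_le (Finset.sum_le_sum fun e _ => ?_)
  split <;> simp

/-- The weight of a configuration. -/
noncomputable def configWeight (Ω : HolantInstance) (σ : Fin Ω.m → Bool) : ℝ :=
  (∏ e, if σ e then Ω.weight e else 1) *
    ∏ v, (Ω.sig v)[Ω.load σ v]'(Ω.load_lt_length σ v)

/-- The partition function. -/
noncomputable def Z (Ω : HolantInstance) : ℝ := ∑ σ : Fin Ω.m → Bool, Ω.configWeight σ

/-- `Ω` is an instance of the problem `Holant(F, Λ)`. -/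
def IsInstanceOf (Ω : HolantInstance) (F : Set (List ℝ)) (Λ : Set ℝ) : Prop :=
  (∀ v, Ω.sig v ∈ F) ∧ ∀ e, Ω.weight e ∈ Λ

end HolantInstance

/-- The family of nonnegative symmetric functions `[f_0, …, f_d]` (of any arity `d`) with
`f_{i+2} = c f_{i+1} + f_i` for `0 ≤ i ≤ d - 2` and
`p f_i ≤ f_{i+1} ≤ q f_i` for `0 ≤ i ≤ d - 1`. -/
def fibonacciFamily (c p q : ℝ) : Set (List ℝ) :=
  {f | (∀ x ∈ f, 0 ≤ x) ∧
    (∀ (i : ℕ) (h : i + 2 < f.length), f[i + 2] = c * f[i + 1] + f[i]) ∧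
    ∀ (i : ℕ) (h : i + 1 < f.length), p * f[i] ≤ f[i + 1] ∧ f[i + 1] ≤ q * f[i]}

/-! ### Programs and their running time

A first-order recursive language whose data are binary trees with real numbers at the leaves.
The numerical operations are the exact field operations and comparison (no rounding), and the only
numerical constants in a program are rational. -/

namespace RealProg

/-- Data: real numbers, the empty list, and pairs. -/
inductive Val where
  | num (x : ℝ) : Val
  | nil : Val
  | cons (a b : Val) : Val

inductive Op where
  | add | sub | mul | div

noncomputable def Op.apply : Op → ℝ → ℝ → ℝ
  | .add, x, y => x + y
  | .sub, x, y => x - y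
  | .mul, x, y => x * y
  | .div, x, y => x / y

/-- Terms. Variables are de Bruijn indices; `bind a b` evaluates `a` and binds its value in `b`;
`ifLe a b s t` is `s` if `a ≤ b` and `t` otherwise; `split a s t` is `s` if `a` is the empty list,
and `t` with the two components bound (the first one to index `0`) if `a` is a pair; `call f a` calls
the `f`-th function of the program with argument `a`. -/
inductive Term where
  | var (i : ℕ) : Term
  | const (q : ℚ) : Term
  | nil : Term
  | cons (a b : Term) : Term
  | arith (o : Op) (a b : Term) : Term
  | bind (a b : Term) : Term
  | ifLe (a b s t : Term) : Term
  | split (a s t : Term) : Term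
  | call (f : ℕ) (a : Term) : Term

/-- A program: the bodies of its (mutually recursive, unary) functions, and its main term, whose
variable `0` is the input. -/
structure Program where
  funs : List Term
  main : Term

/-- `Eval w fs env e v t`: in the environment `env`, the term `e` evaluates to `v` at cost `t`.
Every elementary step costs `1`; an arithmetic operation or a comparison costs in addition the
weights `w` of the numbers involved. Division by zero, comparing or calculating with
something that is not a number, splitting a number, and an undefined variable or function have no
value. -/
inductive Eval (w : ℝ → ℕ) (fs : List Term) : List Val → Term → Val → ℕ → Prop where
  | var {env : List Val} {i : ℕ} {v : Val} (h : env[i]? = some v) :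
      Eval w fs env (.var i) v 1
  | const {env : List Val} (q : ℚ) : Eval w fs env (.const q) (.num q) 1
  | nil {env : List Val} : Eval w fs env .nil .nil 1
  | cons {env : List Val} {a b : Term} {u v : Val} {s t : ℕ}
      (ha : Eval w fs env a u s) (hb : Eval w fs env b v t) :
      Eval w fs env (.cons a b) (.cons u v) (s + t + 1)
  | arith {env : List Val} {o : Op} {a b : Term} {x y : ℝ} {s t : ℕ}
      (ha : Eval w fs env a (.num x) s) (hb : Eval w fs env b (.num y) t)
      (hdiv : o = Op.div → y ≠ 0) :
      Eval w fs env (.arith o a b) (.num (o.apply x y))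
        (s + t + 1 + (w x + w y + w (o.apply x y)))
  | bind {env : List Val} {a b : Term} {u v : Val} {s t : ℕ}
      (ha : Eval w fs env a u s) (hb : Eval w fs (u :: env) b v t) :
      Eval w fs env (.bind a b) v (s + t + 1)
  | ifLe_true {env : List Val} {a b e₁ e₂ : Term} {x y : ℝ} {v : Val} {r s t : ℕ}
      (ha : Eval w fs env a (.num x) r) (hb : Eval w fs env b (.num y) s) (hxy : x ≤ y)
      (he : Eval w fs env e₁ v t) :
      Eval w fs env (.ifLe a b e₁ e₂) v (r + s + t + 1 + (w x + w y))
  | ifLe_false {env : List Val} {a b e₁ e₂ : Term} {x y : ℝ} {v : Val} {r s t : ℕ}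
      (ha : Eval w fs env a (.num x) r) (hb : Eval w fs env b (.num y) s) (hxy : ¬ x ≤ y)
      (he : Eval w fs env e₂ v t) :
      Eval w fs env (.ifLe a b e₁ e₂) v (r + s + t + 1 + (w x + w y))
  | split_nil {env : List Val} {a e₁ e₂ : Term} {v : Val} {s t : ℕ}
      (ha : Eval w fs env a .nil s) (he : Eval w fs env e₁ v t) :
      Eval w fs env (.split a e₁ e₂) v (s + t + 1)
  | split_cons {env : List Val} {a e₁ e₂ : Term} {p q v : Val} {s t : ℕ}
      (ha : Eval w fs env a (.cons p q) s) (he : Eval w fs (p :: q :: env) e₂ v t) :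
      Eval w fs env (.split a e₁ e₂) v (s + t + 1)
  | call {env : List Val} {f : ℕ} {a body : Term} {u v : Val} {s t : ℕ}
      (hf : fs[f]? = some body) (ha : Eval w fs env a u s) (hb : Eval w fs [u] body v t) :
      Eval w fs env (.call f a) v (s + t + 1)

/-- The program `P` halts on `input` with result `v` and cost `t`. -/
def Program.Run (P : Program) (w : ℝ → ℕ) (input v : Val) (t : ℕ) : Prop :=
  Eval w P.funs [input] P.main v t

/-- Evaluation is deterministic: value and cost are determined, and the value does not depend on the
cost measure. -/
theorem Eval.value_unique {w w' : ℝ → ℕ} {fs : List Term} {env : List Val} {e : Term} {v v' : Val}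
    {t t' : ℕ} (h : Eval w fs env e v t) (h' : Eval w' fs env e v' t') :
    v = v' ∧ (w = w' → t = t') := by
  induction h generalizing v' t' <;> cases h' <;> grind

/-- The list `[x_0, …, x_k]` as the tree `(x_0 . (x_1 . ( … . nil)))`. -/
def Val.ofList : List Val → Val
  | [] => .nil
  | a :: l => .cons a (Val.ofList l)

end RealProg

open RealProg in
/-- The input of an approximation scheme: `ε`, the list of the vertex functions (each one the list of
its values), and the list of the edges `((u . v) . weight)`. -/
noncomputable def HolantInstance.encode (Ω : HolantInstance) (ε : ℝ) : Val :=
  .cons (.num ε) (.cons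
    (.ofList (List.ofFn fun v => .ofList ((Ω.sig v).map .num)))
    (.ofList (List.ofFn fun e =>
      .cons (.cons (.num ((Ω.ends e).1 : ℕ)) (.num ((Ω.ends e).2 : ℕ))) (.num (Ω.weight e)))))

/-! ### Cost measures and input sizes -/

/-- Unit cost: every operation on real numbers is one step. -/
def unitCost : ℝ → ℕ := fun _ => 0

/-- `x` is a rational number. -/
def IsRat (x : ℝ) : Prop := ∃ q : ℚ, (q : ℝ) = x

open Classical in
/-- The bit length of numerator and denominator of a rational number (`0` for an irrational one, where
it is not used). -/
noncomputable def bitLength (x : ℝ) : ℕ :=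
  if h : IsRat x then Nat.size h.choose.num.natAbs + Nat.size h.choose.den else 0

namespace HolantInstance

/-- The number of vertices and edges. -/
def size (Ω : HolantInstance) : ℕ := Ω.n + Ω.m

/-- All numbers in the instance are rational. -/
def IsRational (Ω : HolantInstance) : Prop :=
  (∀ v, ∀ x ∈ Ω.sig v, IsRat x) ∧ ∀ e, IsRat (Ω.weight e)

/-- The number of vertices and edges plus the total bit length of the numbers. -/
noncomputable def bitSize (Ω : HolantInstance) : ℕ :=
  Ω.size + (∑ v, ((Ω.sig v).map bitLength).sum) + ∑ e, bitLength (Ω.weight e)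

end HolantInstance

/-! ### Approximation schemes -/

/-- `z` approximates `Z` with relative error less than `ε`; if `Z = 0`, it is exact. -/
def ApproximatesWithin (ε Z z : ℝ) : Prop :=
  (Z ≠ 0 → (1 - ε) * Z < z ∧ z < (1 + ε) * Z) ∧ (Z = 0 → z = 0)

open RealProg in
/-- `Holant(F, Λ)` has a (deterministic) fully polynomial-time approximation scheme: one program
computes, for all instances and all `ε > 0`, an approximation of the partition function within `ε`,

* in a number of steps polynomial in the number of vertices and edges and in `1/ε`, where one
  operation on real numbers is one step;
* and, if all the numbers in the input are rational, also in bit cost polynomial in the bit size of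
  the input and in `1/ε`. -/
def HasFPTAS (F : Set (List ℝ)) (Λ : Set ℝ) : Prop :=
  ∃ (P : Program) (C k : ℕ), ∀ Ω : HolantInstance, Ω.IsInstanceOf F Λ → ∀ ε : ℝ, 0 < ε →
    ∃ z : ℝ, ApproximatesWithin ε Ω.Z z ∧
      (∃ t : ℕ, P.Run unitCost (Ω.encode ε) (.num z) t ∧
        (t : ℝ) ≤ C * (Ω.size + 1 / ε + 1) ^ k) ∧
      (Ω.IsRational → IsRat ε →
        ∃ t : ℕ, P.Run bitLength (Ω.encode ε) (.num z) t ∧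
          (t : ℝ) ≤ C * (Ω.bitSize + bitLength ε + 1 / ε + 1) ^ k)

/-!
Let `p_v` denote the ratio of the partition function with the function at `v` shifted by one place
to the partition function itself. Deleting an edge `e = uv` of weight `w` expresses the partition
function as `Z(G - e) * (1 + w * p_v(G - e) * p_u(G - e, v shifted))`, and the Fibonacci
recurrence turns this into a recursion for `p_v(G)` in terms of three such ratios on `G - e`. All
ratios lie in `[c / 2, c + 2 / c]`. In the coordinate `log ((r - 1 / 4) / (2 - r))`, where
`r = p_v / c`, the recursion contracts distances by a factor `< 1` which depends only on
`w * c ^ 2`. So breaking off the recursion at a depth logarithmic in `(|E| + 1) * (1 + 1 / ε)`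
yields every ratio up to a small relative error, and `Z(G)` is the product of the factors
`1 + w * p_v * p_u` over the edges, removed one after the other, times the product of the values
`f_0`. If some `f_0` vanishes, so does the whole function at that vertex, and `Z(G) = 0`.

The recursion tree has `3 ^ depth` nodes, which is polynomial in `|E|` and `1 / ε`. As one level
of the recursion multiplies the bit length of the numbers by at most a constant, the same holds
for the bit cost.
-/

namespace FibHolant

/-! ### Contraction of the marginal recursion -/

section Contraction

/-- Up to the factor `4 / 7`, the derivative of the inverse of `potential`, as a function of the
value of that inverse. -/
noncomputable def speed (r : ℝ) : ℝ := (r - 1 / 4) * (2 - r)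

theorem speed_le_mul (r : ℝ) : speed r ≤ 0.84 * r := by
  unfold speed
  nlinarith [sq_nonneg (r - 0.705)]

theorem speed_le_one (r : ℝ) : speed r ≤ 1 := by
  unfold speed
  nlinarith [sq_nonneg (r - 9 / 8)]

theorem speed_pos {r : ℝ} (hr : r ∈ Set.Ioo (1 / 4) 2) : 0 < speed r :=
  mul_pos (sub_pos.2 hr.1) (sub_pos.2 hr.2)

/-- The recursion for marginals of signatures with `f_{i+2} = c f_{i+1} + d f_i`. Here `w` is the
weight of the edge that is removed, `a` and `b` are the marginals at one end of it with the other
end unshifted and shifted, respectively, and `β` is the marginal at the other end. Dividing all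
marginals by `c` replaces `c`, `d` and `w` by `1`, `d / c ^ 2` and `w * c ^ 2`. -/
noncomputable def marginalStep (c d w a b β : ℝ) : ℝ :=
  (a + w * β * (c * b + d)) / (1 + w * β * b)

theorem marginalStep_div {c w a b β : ℝ} (hc : c ≠ 0) :
    marginalStep c 1 w a b β / c =
      marginalStep 1 (1 / c ^ 2) (w * c ^ 2) (a / c) (b / c) (β / c) := by
  have h : w * c ^ 2 * (β / c) * (b / c) = w * β * b := by field_simp
  rw [marginalStep, marginalStep, h, div_right_comm]
  congr 1
  field_simp

/-- The coefficient of `ν = w * β` in the expansion `speed_marginalStep_mul_sq`. -/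
noncomputable def linCoeff (η a b : ℝ) : ℝ := (a - 1 / 4) * (b - η) + (2 - a) * (3 / 4 * b + η)

/-- The coefficient of `ν ^ 2` in the expansion `speed_marginalStep_mul_sq`. -/
noncomputable def quadCoeff (η b : ℝ) : ℝ := (3 / 4 * b + η) * (b - η)

theorem speed_marginalStep_mul_sq {η w a b β : ℝ} (hD : 1 + w * β * b ≠ 0) :
    speed (marginalStep 1 η w a b β) * (1 + w * β * b) ^ 2 =
      speed a + w * β * linCoeff η a b + (w * β) ^ 2 * quadCoeff η b := by
  simp only [speed, marginalStep, linCoeff, quadCoeff]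
  field_simp
  ring

/-- The interval that contains all marginals, in units of `c`, where `η = 1 / c ^ 2`. -/
def box (η : ℝ) : Set ℝ := Set.Icc (1 / 2) (1 + 2 * η)

theorem mem_Ioo_of_mem_box {η r : ℝ} (hη : η ≤ 0.1515) (hr : r ∈ box η) :
    r ∈ Set.Ioo (1 / 4) 2 :=
  ⟨by linarith [hr.1], by linarith [hr.2]⟩

theorem marginalStep_mem_box {η w a b β : ℝ} (hη : 0 ≤ η) (hw : 0 ≤ w) (ha : a ∈ box η)
    (hb : b ∈ box η) (hβ : β ∈ box η) : marginalStep 1 η w a b β ∈ box η := by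
  obtain ⟨ha, ha'⟩ := ha
  have hb := hb.1
  have hν : 0 ≤ w * β := mul_nonneg hw (by linarith [hβ.1])
  have hD : 0 < 1 + w * β * b := by nlinarith
  constructor
  · rw [marginalStep, le_div_iff₀ hD]
    nlinarith
  · rw [marginalStep, div_le_iff₀ hD]
    nlinarith [mul_nonneg hν (mul_nonneg hη (sub_nonneg.2 hb))]

variable {η a b : ℝ}

theorem linCoeff_ge (hη : 0 ≤ η) (hη' : η ≤ 0.1515) (ha : a ∈ box η) (hb : 1 / 2 ≤ b) :
    0.3 ≤ linCoeff η a b := by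
  unfold linCoeff
  nlinarith [ha.1, ha.2, mul_nonneg (sub_nonneg.2 ha.1) (sub_nonneg.2 hb),
    mul_nonneg (sub_nonneg.2 ha.2) (sub_nonneg.2 hb)]

theorem linear_gradient_le_of_le_one (hη : 0 ≤ η) (hη' : η ≤ 0.1515) (ha : 1 / 2 ≤ a)
    (ha' : a ≤ 1) (hb : 1 / 2 ≤ b) :
    speed a * b + |1 - a| * speed b + |b + η - a * b| * 0.84 ≤ 0.9 * linCoeff η a b := by
  unfold speed linCoeff
  rw [abs_of_nonneg (by linarith), abs_of_nonneg (by nlinarith)]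
  nlinarith [mul_nonneg (sub_nonneg.2 ha') (sq_nonneg (b - 0.7)),
    mul_nonneg (sub_nonneg.2 ha) (sub_nonneg.2 hb),
    mul_nonneg (mul_nonneg (sub_nonneg.2 ha) (sub_nonneg.2 ha)) (sub_nonneg.2 hb),
    mul_nonneg (sub_nonneg.2 ha) (sub_nonneg.2 hη'), mul_nonneg (sub_nonneg.2 ha') hη,
    mul_nonneg (sub_nonneg.2 ha') (sub_nonneg.2 ha)]

theorem linear_gradient_le_of_one_le (hη' : η ≤ 0.1515) (ha : 1 ≤ a)
    (ha' : a ≤ 1 + 2 * η) (hb : b ∈ box η) :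
    speed a * b + |1 - a| * speed b + |b + η - a * b| * 0.84 ≤ 0.9 * linCoeff η a b := by
  obtain ⟨hb, hb'⟩ := hb
  obtain ⟨h, rfl⟩ : ∃ h, a = 1 + h := ⟨a - 1, by ring⟩
  have h0 : 0 ≤ h := by linarith
  have h2 : h ≤ 0.303 := by linarith
  have hquad : h * (2.275 * b - b ^ 2 - 0.5) ≤ 0.303 * (1.275 * b - 0.25) :=
    mul_le_mul h2 (by nlinarith [sq_nonneg (b - 0.5)]) (by nlinarith) (by norm_num)
  unfold speed linCoeff
  rw [abs_of_nonpos (by linarith)]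
  rcases abs_cases (b + η - (1 + h) * b) with ⟨habs, -⟩ | ⟨habs, -⟩ <;> rw [habs] <;>
  nlinarith [mul_nonneg h0 (sub_nonneg.2 hb), mul_nonneg h0 (sub_nonneg.2 hη'),
    mul_nonneg (mul_nonneg h0 h0) (sub_nonneg.2 hb),
    mul_nonneg (sub_nonneg.2 h2) (sub_nonneg.2 hb)]

theorem linear_gradient_le (hη : 0 ≤ η) (hη' : η ≤ 0.1515) (ha : a ∈ box η) (hb : b ∈ box η) :
    speed a * b + |1 - a| * speed b + |b + η - a * b| * 0.84 ≤ 0.9 * linCoeff η a b :=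
  (le_total a 1).elim (fun h => linear_gradient_le_of_le_one hη hη' ha.1 h hb.1)
    fun h => linear_gradient_le_of_one_le hη' h ha.2 hb

theorem quadratic_gradient_le (hη : 0 ≤ η) (hη' : η ≤ 0.1515) (hb : b ∈ box η) :
    η * speed b ≤ 0.9 * quadCoeff η b := by
  unfold speed quadCoeff
  nlinarith [hb.1, hb.2, mul_nonneg (sub_nonneg.2 hb.1) (sub_nonneg.2 hb.2),
    mul_nonneg hη (sub_nonneg.2 hb.1), mul_nonneg hη (sub_nonneg.2 hη')]

/-- The factor by which the recursion contracts distances (with respect to the potential) if, in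
units of `c`, all edge weights are at least `k`. -/
noncomputable def rate (k : ℝ) : ℝ := 1 - 0.1 * (0.15 * k / (1 + 0.15 * k))

theorem rate_pos {k : ℝ} (hk : 0 ≤ k) : 0 < rate k := by
  have : 0.15 * k / (1 + 0.15 * k) ≤ 1 := by
    rw [div_le_one (by positivity)]; linarith
  unfold rate; linarith

theorem rate_lt_one {k : ℝ} (hk : 0 < k) : rate k < 1 := by
  have : 0 < 0.15 * k / (1 + 0.15 * k) := by positivity
  unfold rate; linarith

theorem add_mul_le_rate_mul_add {k x S : ℝ} (hk : 0 ≤ k) (hx : x ≤ 1) (hS : 0.15 * k ≤ S) :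
    x + 0.9 * S ≤ rate k * (x + S) := by
  have : 0.15 * k / (1 + 0.15 * k) * (x + S) ≤ S := by
    rw [div_mul_eq_mul_div, div_le_iff₀ (by positivity)]
    nlinarith
  unfold rate
  nlinarith

/-- The left hand side bounds the derivative of the potential of `marginalStep` along curves whose
potentials have speed at most `1`, up to a common denominator. -/
theorem gradient_le {k w β : ℝ} (hη : 0 ≤ η) (hη' : η ≤ 0.1515) (hk : 0 ≤ k)
    (hkw : k ≤ w) (ha : a ∈ box η) (hb : b ∈ box η) (hβ : β ∈ box η) :
    speed a * (1 + w * β * b) + w * β * |1 - a - w * β * η| * speed b +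
      w * |b + η - a * b| * speed β ≤
    rate k * (speed (marginalStep 1 η w a b β) * (1 + w * β * b) ^ 2) := by
  have hw : 0 ≤ w := hk.trans hkw
  have hβ0 : 0 ≤ β := by linarith [hβ.1]
  have hb0 : 0 ≤ b := by linarith [hb.1]
  have hν : 0 ≤ w * β := mul_nonneg hw hβ0
  have hνk : k / 2 ≤ w * β := by nlinarith [hβ.1]
  have hsb : 0 < speed b := speed_pos (mem_Ioo_of_mem_box hη' hb)
  have hquad := quadratic_gradient_le hη hη' hb
  have hlin_ge := linCoeff_ge hη hη' ha hb.1
  have hquad_nonneg : 0 ≤ quadCoeff η b := by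
    have : 0 ≤ η * speed b := by positivity
    linarith
  have hterm_b : |1 - a - w * β * η| ≤ |1 - a| + w * β * η :=
    (abs_sub (1 - a) (w * β * η)).trans_eq (by rw [abs_of_nonneg (mul_nonneg hν hη)])
  calc
    _ ≤ speed a * (1 + w * β * b) + w * β * (|1 - a| + w * β * η) * speed b +
        w * |b + η - a * b| * (0.84 * β) := by
      gcongr
      exact speed_le_mul β
    _ = speed a + w * β * (speed a * b + |1 - a| * speed b + |b + η - a * b| * 0.84) +
        (w * β) ^ 2 * (η * speed b) := by ring
    _ ≤ speed a + w * β * (0.9 * linCoeff η a b) + (w * β) ^ 2 * (0.9 * quadCoeff η b) := by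
      gcongr
      exact linear_gradient_le hη hη' ha hb
    _ = speed a + 0.9 * (w * β * linCoeff η a b + (w * β) ^ 2 * quadCoeff η b) := by ring
    _ ≤ rate k * (speed a + (w * β * linCoeff η a b + (w * β) ^ 2 * quadCoeff η b)) :=
      add_mul_le_rate_mul_add hk (speed_le_one a) (by
        nlinarith only [hk, hνk, hlin_ge, mul_nonneg (sq_nonneg (w * β)) hquad_nonneg])
    _ = _ := by rw [speed_marginalStep_mul_sq (by positivity), add_assoc]

/-- The coordinate in which the recursion for marginals in units of `c` is a contraction. -/
noncomputable def potential (r : ℝ) : ℝ := Real.log ((r - 1 / 4) / (2 - r))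

/-- The inverse of `potential`. -/
noncomputable def fromPotential (x : ℝ) : ℝ := (1 / 4 + 2 * Real.exp x) / (1 + Real.exp x)

theorem fromPotential_potential {r : ℝ} (hr : r ∈ Set.Ioo (1 / 4) 2) :
    fromPotential (potential r) = r := by
  have h1 : 0 < r - 1 / 4 := sub_pos.2 hr.1
  have h2 : 0 < 2 - r := sub_pos.2 hr.2
  rw [fromPotential, potential, Real.exp_log (by positivity)]
  have : 1 + (r - 1 / 4) / (2 - r) ≠ 0 := by positivity
  field_simp
  ring

theorem fromPotential_mono : Monotone fromPotential := by
  intro x y hxy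
  have := Real.exp_le_exp.2 hxy
  rw [fromPotential, fromPotential, div_le_div_iff₀ (by positivity) (by positivity)]
  nlinarith

theorem hasDerivAt_fromPotential (x : ℝ) :
    HasDerivAt fromPotential (4 / 7 * speed (fromPotential x)) x := by
  have := Real.exp_pos x
  have h := (((Real.hasDerivAt_exp x).const_mul 2).const_add (1 / 4)).div
    ((Real.hasDerivAt_exp x).const_add 1) (by positivity)
  refine h.congr_deriv ?_
  unfold speed fromPotential
  field_simp
  ring

theorem hasDerivAt_potential {r : ℝ} (hr : r ∈ Set.Ioo (1 / 4) 2) :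
    HasDerivAt potential (7 / 4 / speed r) r := by
  have h1 : r - 1 / 4 ≠ 0 := (sub_pos.2 hr.1).ne'
  have h2 : 2 - r ≠ 0 := (sub_pos.2 hr.2).ne'
  have h := (((hasDerivAt_id r).sub_const (1 / 4)).div ((hasDerivAt_id r).const_sub 2) h2).log
    (div_ne_zero h1 h2)
  refine h.congr_deriv ?_
  simp only [speed, id, Pi.div_apply]
  field_simp
  ring

/-- The curve from `r` to `r'` whose potential is affine in the parameter `s ∈ [0, 1]`. -/
noncomputable def potentialSegment (r r' s : ℝ) : ℝ :=
  fromPotential (potential r + s * (potential r' - potential r))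

theorem potentialSegment_zero {r : ℝ} (hr : r ∈ Set.Ioo (1 / 4) 2) (r' : ℝ) :
    potentialSegment r r' 0 = r := by
  rw [potentialSegment, zero_mul, add_zero, fromPotential_potential hr]

theorem potentialSegment_one (r : ℝ) {r' : ℝ} (hr' : r' ∈ Set.Ioo (1 / 4) 2) :
    potentialSegment r r' 1 = r' := by
  rw [potentialSegment, one_mul, add_sub_cancel, fromPotential_potential hr']

theorem potentialSegment_mem_uIcc {r r' s : ℝ} (hr : r ∈ Set.Ioo (1 / 4) 2)
    (hr' : r' ∈ Set.Ioo (1 / 4) 2) (hs : s ∈ Set.Icc (0 : ℝ) 1) :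
    potentialSegment r r' s ∈ Set.uIcc r r' := by
  have hmem : potential r + s * (potential r' - potential r) ∈
      Set.uIcc (potential r) (potential r') := by
    rcases le_total (potential r) (potential r') with h | h
    · rw [Set.uIcc_of_le h]
      constructor <;> nlinarith [hs.1, hs.2]
    · rw [Set.uIcc_of_ge h]
      constructor <;> nlinarith [hs.1, hs.2]
  have := fromPotential_mono.mapsTo_uIcc hmem
  rwa [fromPotential_potential hr, fromPotential_potential hr'] at this

theorem potentialSegment_mem_box {r r' s : ℝ} (hη' : η ≤ 0.1515) (hr : r ∈ box η)
    (hr' : r' ∈ box η) (hs : s ∈ Set.Icc (0 : ℝ) 1) : potentialSegment r r' s ∈ box η :=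
  Set.uIcc_subset_Icc hr hr'
    (potentialSegment_mem_uIcc (mem_Ioo_of_mem_box hη' hr) (mem_Ioo_of_mem_box hη' hr') hs)

theorem hasDerivAt_potentialSegment (r r' s : ℝ) :
    HasDerivAt (potentialSegment r r')
      (4 / 7 * speed (potentialSegment r r' s) * (potential r' - potential r)) s := by
  have h : HasDerivAt (fun s => potential r + s * (potential r' - potential r))
      (potential r' - potential r) s := by
    simpa using ((hasDerivAt_id s).mul_const (potential r' - potential r)).const_add (potential r)
  exact (hasDerivAt_fromPotential _).comp s h

theorem hasDerivAt_potential_marginalStep {w s x y z : ℝ} {A B C : ℝ → ℝ}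
    (hA : HasDerivAt A (4 / 7 * speed (A s) * x) s)
    (hB : HasDerivAt B (4 / 7 * speed (B s) * y) s)
    (hC : HasDerivAt C (4 / 7 * speed (C s) * z) s) (hD : 1 + w * C s * B s ≠ 0)
    (hF : marginalStep 1 η w (A s) (B s) (C s) ∈ Set.Ioo (1 / 4) 2) :
    HasDerivAt (fun s => potential (marginalStep 1 η w (A s) (B s) (C s)))
      ((speed (A s) * (1 + w * C s * B s) * x +
          w * C s * (1 - A s - w * C s * η) * speed (B s) * y +
          w * (B s + η - A s * B s) * speed (C s) * z) /
        (speed (marginalStep 1 η w (A s) (B s) (C s)) * (1 + w * C s * B s) ^ 2)) s := by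
  have hstep := (hA.add ((hC.const_mul w).mul ((hB.const_mul 1).add_const η))).div
    (((hC.const_mul w).mul hB).const_add 1) hD
  refine ((hasDerivAt_potential hF).comp s hstep).congr_deriv ?_
  have := (speed_pos hF).ne'
  simp only [Pi.mul_apply, Pi.add_apply]
  field_simp
  ring

theorem potential_marginalStep_dist_le {k w δ a b β a' b' β' : ℝ} (hη : 0 ≤ η)
    (hη' : η ≤ 0.1515) (hk : 0 ≤ k) (hkw : k ≤ w) (ha : a ∈ box η) (hb : b ∈ box η)
    (hβ : β ∈ box η) (ha' : a' ∈ box η) (hb' : b' ∈ box η) (hβ' : β' ∈ box η)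
    (hda : |potential a' - potential a| ≤ δ) (hdb : |potential b' - potential b| ≤ δ)
    (hdβ : |potential β' - potential β| ≤ δ) :
    |potential (marginalStep 1 η w a' b' β') - potential (marginalStep 1 η w a b β)| ≤
      rate k * δ := by
  have hδ : 0 ≤ δ := (abs_nonneg _).trans hda
  have hw : 0 ≤ w := hk.trans hkw
  let G (s : ℝ) : ℝ := potential (marginalStep 1 η w (potentialSegment a a' s)
    (potentialSegment b b' s) (potentialSegment β β' s))
  have hderiv : ∀ s ∈ Set.Icc (0 : ℝ) 1, ∃ g, HasDerivAt G g s ∧ |g| ≤ rate k * δ := by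
    intro s hs
    have hA := potentialSegment_mem_box hη' ha ha' hs
    have hB := potentialSegment_mem_box hη' hb hb' hs
    have hC := potentialSegment_mem_box hη' hβ hβ' hs
    have hF := mem_Ioo_of_mem_box hη' (marginalStep_mem_box hη hw hA hB hC)
    have hsA := speed_pos (mem_Ioo_of_mem_box hη' hA)
    have hsB := speed_pos (mem_Ioo_of_mem_box hη' hB)
    have hsC := speed_pos (mem_Ioo_of_mem_box hη' hC)
    have hB0 : 0 ≤ potentialSegment b b' s := by linarith [hB.1]
    have hC0 : 0 ≤ potentialSegment β β' s := by linarith [hC.1]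
    have hD : 0 < 1 + w * potentialSegment β β' s * potentialSegment b b' s := by positivity
    refine ⟨_, hasDerivAt_potential_marginalStep (hasDerivAt_potentialSegment _ _ s)
      (hasDerivAt_potentialSegment _ _ s) (hasDerivAt_potentialSegment _ _ s) hD.ne' hF, ?_⟩
    have hden := mul_pos (speed_pos hF) (pow_pos hD 2)
    rw [abs_div, abs_of_pos hden, div_le_iff₀ hden,
      mul_right_comm (rate k)]
    refine le_trans ?_ (mul_le_mul_of_nonneg_right (gradient_le hη hη' hk hkw hA hB hC) hδ)
    refine (abs_add_three _ _ _).trans ?_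
    simp only [abs_mul, abs_of_pos hsA, abs_of_pos hsB, abs_of_pos hsC, abs_of_pos hD,
      abs_of_nonneg hw, abs_of_nonneg hC0, add_mul]
    gcongr
  choose! g hg hg' using hderiv
  have hdist := norm_image_sub_le_of_norm_deriv_le_segment_01' (f := G) (f' := g)
    (fun s hs => (hg s hs).hasDerivWithinAt) (fun s hs => hg' s ⟨hs.1, hs.2.le⟩)
  have hIoo {r : ℝ} (hr : r ∈ box η) := mem_Ioo_of_mem_box hη' hr
  simpa only [G, potentialSegment_zero (hIoo ha), potentialSegment_zero (hIoo hb),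
    potentialSegment_zero (hIoo hβ), potentialSegment_one _ (hIoo ha'),
    potentialSegment_one _ (hIoo hb'), potentialSegment_one _ (hIoo hβ'), Real.norm_eq_abs]
    using hdist

end Contraction

/-! ### The partition function as a recursion over the edges -/

/-- An edge of a graph whose vertices are natural numbers, with its weight. -/
structure Edge where
  left : ℕ
  right : ℕ
  weight : ℝ

/-- The ends of `e` are among the vertices `0, …, n - 1`, and the weight of `e` is at least `lam`.
-/
structure Edge.Admissible (n : ℕ) (lam : ℝ) (e : Edge) : Prop where
  left_lt : e.left < n
  right_lt : e.right < n
  le_weight : lam ≤ e.weight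

/-- The vertex functions: `s v i` is the value of the function at `v` on inputs of Hamming weight
`i`. The sequences are infinite, so that the arity of a function need not be recorded. -/
abbrev State := ℕ → ℕ → ℝ

/-- The vertex functions with one more input at `v` pinned to `1`. -/
def shift (v : ℕ) (s : State) : State := fun x i => s x (i + if x = v then 1 else 0)

/-- The partition function of the graph with vertices `0, …, n - 1` and the given edges, by the
decision whether the first edge is chosen. Inputs which do not belong to an edge are pinned to
`0`. -/
noncomputable def partition (n : ℕ) : State → List Edge → ℝ
  | s, [] => ∏ x ∈ Finset.range n, s x 0
  | s, e :: E => partition n s E + e.weight * partition n (shift e.left (shift e.right s)) E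

/-- A sequence that extends a nonzero function in `fibonacciFamily c (c / 2) (c + 2 / c)`. Only the
first ratio is constrained, since the recurrence propagates the bounds (`IsFibSeq.succ`). -/
structure IsFibSeq (c : ℝ) (f : ℕ → ℝ) : Prop where
  pos : 0 < f 0
  lower : c / 2 * f 0 ≤ f 1
  upper : f 1 ≤ (c + 2 / c) * f 0
  recurrence : ∀ i, f (i + 2) = c * f (i + 1) + f i

/-- All vertex functions are Fibonacci sequences. -/
def IsFib (c : ℝ) (s : State) : Prop := ∀ v, IsFibSeq c (s v)

/-- The other end and the weight of the first edge at `v` together with the remaining edges, if some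
edge is incident with `v`. -/
noncomputable def extract (v : ℕ) : List Edge → Option (ℕ × ℝ × List Edge)
  | [] => none
  | e :: E =>
    if e.left = v then some (e.right, e.weight, E)
    else if e.right = v then some (e.left, e.weight, E)
    else (extract v E).map fun r => (r.1, r.2.1, e :: r.2.2)

section Partition

variable {n u v : ℕ} {c w : ℝ} {s : State} {E E' : List Edge}

theorem shift_self (v : ℕ) (s : State) (i : ℕ) : shift v s v i = s v (i + 1) := by
  simp [shift]

theorem shift_of_ne (h : u ≠ v) (s : State) : shift v s u = s u := by
  funext i
  simp [shift, h]

theorem shift_comm (u v : ℕ) (s : State) : shift u (shift v s) = shift v (shift u s) := by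
  funext x i
  simp only [shift, add_right_comm]

theorem shift_recurrence (hs : ∀ i, s v (i + 2) = c * s v (i + 1) + s v i) (u i : ℕ) :
    shift u s v (i + 2) = c * shift u s v (i + 1) + shift u s v i := by
  simpa only [shift, add_right_comm] using hs (i + if v = u then 1 else 0)

theorem IsFibSeq.succ (hc : 0 < c) {f : ℕ → ℝ} (h : IsFibSeq c f) :
    IsFibSeq c fun i => f (i + 1) := by
  have h0 := h.pos
  have h1 : 0 < f 1 := (mul_pos (by positivity) h0).trans_le h.lower
  have h2 : f 2 = c * f 1 + f 0 := h.recurrence 0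
  refine ⟨h1, ?_, ?_, fun i => h.recurrence (i + 1)⟩
  · simp only [zero_add, one_add_one_eq_two, h2]
    nlinarith
  · have : 2 / c * (c / 2 * f 0) ≤ 2 / c * f 1 := mul_le_mul_of_nonneg_left h.lower (by positivity)
    have : 2 / c * (c / 2 * f 0) = f 0 := by field_simp
    simp only [zero_add, one_add_one_eq_two, h2]
    linarith

theorem IsFib.shift (hc : 0 < c) (hs : IsFib c s) (v : ℕ) : IsFib c (shift v s) := by
  intro x
  obtain rfl | hx := eq_or_ne x v
  · exact funext (shift_self x s) ▸ (hs x).succ hc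
  · exact shift_of_ne hx s ▸ hs x

theorem partition_pos (hc : 0 < c) (hs : IsFib c s) (hE : ∀ e ∈ E, 0 ≤ e.weight) :
    0 < partition n s E := by
  induction E generalizing s with
  | nil => exact Finset.prod_pos fun x _ => (hs x).pos
  | cons e E ih =>
    rw [List.forall_mem_cons] at hE
    have := ih hs hE.2
    have := ih ((hs.shift hc e.right).shift hc e.left) hE.2
    have := hE.1
    rw [partition]
    positivity

theorem partition_nil_eq_mul (hv : v < n) (s : State) :
    partition n s [] = s v 0 * ∏ x ∈ (Finset.range n).erase v, s x 0 :=
  (Finset.mul_prod_erase _ _ (Finset.mem_range.2 hv)).symm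

theorem partition_shift_nil (hv : v < n) (s : State) :
    partition n (shift v s) [] = s v 1 * ∏ x ∈ (Finset.range n).erase v, s x 0 := by
  rw [partition_nil_eq_mul hv, shift_self, zero_add]
  congr 1
  exact Finset.prod_congr rfl fun x hx => by rw [shift_of_ne (Finset.ne_of_mem_erase hx)]

theorem partition_shift_cons (v : ℕ) (s : State) (e : Edge) (E : List Edge) :
    partition n (shift v s) (e :: E) = partition n (shift v s) E +
      e.weight * partition n (shift v (shift e.left (shift e.right s))) E := by
  rw [partition, shift_comm e.right v, shift_comm e.left v]

theorem partition_shift_bounds (hc : 0 < c) (hv : v < n) (hs : IsFib c s)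
    (hE : ∀ e ∈ E, 0 ≤ e.weight) :
    c / 2 * partition n s E ≤ partition n (shift v s) E ∧
      partition n (shift v s) E ≤ (c + 2 / c) * partition n s E := by
  induction E generalizing s with
  | nil =>
    have h := Finset.prod_nonneg (s := (Finset.range n).erase v) fun x _ => (hs x).pos.le
    rw [partition_shift_nil hv, partition_nil_eq_mul hv, ← mul_assoc, ← mul_assoc]
    exact ⟨mul_le_mul_of_nonneg_right (hs v).lower h, mul_le_mul_of_nonneg_right (hs v).upper h⟩
  | cons e E ih =>
    rw [List.forall_mem_cons] at hE
    have h1 := ih hs hE.2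
    have h2 := ih ((hs.shift hc e.right).shift hc e.left) hE.2
    rw [partition_shift_cons, partition]
    constructor
    · nlinarith [mul_le_mul_of_nonneg_left h2.1 hE.1]
    · nlinarith [mul_le_mul_of_nonneg_left h2.2 hE.1]

theorem partition_shift_shift (hv : v < n) (E : List Edge)
    (hs : ∀ i, s v (i + 2) = c * s v (i + 1) + s v i) :
    partition n (shift v (shift v s)) E = c * partition n (shift v s) E + partition n s E := by
  induction E generalizing s with
  | nil =>
    rw [partition_shift_nil hv, partition_shift_nil hv, partition_nil_eq_mul hv, shift_self, hs 0,
      Finset.prod_congr rfl fun x hx => by rw [shift_of_ne (Finset.ne_of_mem_erase hx)]]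
    ring
  | cons e E ih =>
    rw [partition_shift_cons, partition_shift_cons, partition, shift_comm e.right v,
      shift_comm e.left v, ih hs, ih (shift_recurrence (shift_recurrence hs _) _)]
    ring

theorem partition_perm (h : E.Perm E') (s : State) : partition n s E = partition n s E' := by
  induction h generalizing s with
  | nil => rfl
  | cons e _ ih => rw [partition, partition, ih, ih]
  | swap e e' E =>
    simp only [partition]
    rw [shift_comm e.right e'.left, shift_comm e.right e'.right, shift_comm e.left e'.left,
      shift_comm e.left e'.right]
    ring
  | trans _ _ ih₁ ih₂ => rw [ih₁, ih₂]

theorem partition_shift_of_not_incident (hv : v < n)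
    (hE : ∀ e ∈ E, e.left ≠ v ∧ e.right ≠ v) (s : State) :
    partition n (shift v s) E * s v 0 = s v 1 * partition n s E := by
  induction E generalizing s with
  | nil =>
    rw [partition_shift_nil hv, partition_nil_eq_mul hv]
    ring
  | cons e E ih =>
    rw [List.forall_mem_cons] at hE
    have h1 := ih hE.2 s
    have h2 := ih hE.2 (shift e.left (shift e.right s))
    rw [shift_of_ne hE.1.1.symm, shift_of_ne hE.1.2.symm] at h2
    rw [partition_shift_cons, partition, add_mul, h1, mul_assoc, h2]
    ring

theorem not_incident_of_extract_eq_none (h : extract v E = none) :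
    ∀ e ∈ E, e.left ≠ v ∧ e.right ≠ v := by
  induction E with
  | nil => simp
  | cons e E ih =>
    rw [extract] at h
    split_ifs at h with hl hr
    rw [Option.map_eq_none_iff] at h
    exact List.forall_mem_cons.2 ⟨⟨hl, hr⟩, ih h⟩

theorem extract_perm (h : extract v E = some (u, w, E')) :
    E.Perm (⟨v, u, w⟩ :: E') ∨ E.Perm (⟨u, v, w⟩ :: E') := by
  induction E generalizing E' with
  | nil => simp [extract] at h
  | cons e E ih =>
    rw [extract] at h
    split_ifs at h with hl hr
    · cases h
      exact .inl (hl ▸ .refl _)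
    · cases h
      exact .inr (hr ▸ .refl _)
    · obtain ⟨⟨u', w', F⟩, hF, h⟩ := Option.map_eq_some_iff.1 h
      cases h
      exact (ih hF).imp (fun h => (h.cons e).trans (.swap _ _ _))
        fun h => (h.cons e).trans (.swap _ _ _)

theorem forall_mem_of_extract {p : Edge → Prop} (hE : ∀ e ∈ E, p e)
    (h : extract v E = some (u, w, E')) :
    (p ⟨v, u, w⟩ ∨ p ⟨u, v, w⟩) ∧ ∀ e ∈ E', p e := by
  rcases extract_perm h with h | h
  · exact ⟨.inl (hE _ (h.mem_iff.2 List.mem_cons_self)),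
      fun e he => hE e (h.mem_iff.2 (List.mem_cons_of_mem _ he))⟩
  · exact ⟨.inr (hE _ (h.mem_iff.2 List.mem_cons_self)),
      fun e he => hE e (h.mem_iff.2 (List.mem_cons_of_mem _ he))⟩

theorem nonneg_of_extract (hE : ∀ e ∈ E, 0 ≤ e.weight)
    (h : extract v E = some (u, w, E')) : 0 ≤ w ∧ ∀ e ∈ E', 0 ≤ e.weight :=
  (forall_mem_of_extract hE h).imp_left (·.elim id id)

theorem admissible_of_extract {lam : ℝ} (hE : ∀ e ∈ E, e.Admissible n lam)
    (h : extract v E = some (u, w, E')) : u < n ∧ lam ≤ w ∧ ∀ e ∈ E', e.Admissible n lam := by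
  obtain ⟨he | he, hE'⟩ := forall_mem_of_extract hE h
  · exact ⟨he.right_lt, he.le_weight, hE'⟩
  · exact ⟨he.left_lt, he.le_weight, hE'⟩

theorem partition_of_extract_eq_some (h : extract v E = some (u, w, E')) (s : State) :
    partition n s E = partition n s E' + w * partition n (shift v (shift u s)) E' := by
  rcases extract_perm h with h | h
  · rw [partition_perm h, partition]
  · rw [partition_perm h, partition, shift_comm]

end Partition

/-! ### Marginals -/

/-- The ratio of the partition functions with an additional input at `v` pinned to `1` and to `0`.
-/
noncomputable def marginal (n v : ℕ) (s : State) (E : List Edge) : ℝ :=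
  partition n (shift v s) E / partition n s E

/-- The recursion for `marginal` of Fibonacci sequences, cut off at a given depth, where it
returns the marginal at an isolated vertex. -/
noncomputable def truncMarginal (c : ℝ) : ℕ → ℕ → State → List Edge → ℝ
  | 0, v, s, _ => s v 1 / s v 0
  | l + 1, v, s, E =>
    match extract v E with
    | none => s v 1 / s v 0
    | some (u, w, E') =>
      marginalStep c 1 w (truncMarginal c l v s E') (truncMarginal c l v (shift u s) E')
        (truncMarginal c l u s E')

/-- The product formula for the partition function that removes the edges one by one, with
`truncMarginal` of depth `l` in place of `marginal`. -/
noncomputable def approxPartition (n : ℕ) (c : ℝ) (l : ℕ) (s : State) : List Edge → ℝ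
  | [] => ∏ x ∈ Finset.range n, s x 0
  | e :: E => approxPartition n c l s E * (1 + e.weight *
      (truncMarginal c l e.right s E * truncMarginal c l e.left (shift e.right s) E))

section Marginals

variable {n u v : ℕ} {c w lam : ℝ} {s : State} {E E' : List Edge}

theorem div_mem_box_iff (hc : 0 < c) {r : ℝ} :
    r / c ∈ box (1 / c ^ 2) ↔ c / 2 ≤ r ∧ r ≤ c + 2 / c := by
  have : (1 + 2 * (1 / c ^ 2)) * c = c + 2 / c := by field_simp
  rw [box, Set.mem_Icc, le_div_iff₀ hc, div_le_iff₀ hc, this, one_div_mul_eq_div]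

theorem pos_of_div_mem_box (hc : 0 < c) {r : ℝ} (h : r / c ∈ box (1 / c ^ 2)) : 0 < r := by
  linarith [((div_mem_box_iff hc).1 h).1]

theorem one_div_sq_le (hc : 2.57 ≤ c) : 1 / c ^ 2 ≤ 0.1515 := by
  rw [div_le_iff₀ (by positivity)]
  nlinarith

theorem IsFibSeq.div_mem_box (hc : 0 < c) {f : ℕ → ℝ} (hf : IsFibSeq c f) :
    f 1 / f 0 / c ∈ box (1 / c ^ 2) :=
  (div_mem_box_iff hc).2 ⟨(le_div_iff₀ hf.pos).2 hf.lower, (div_le_iff₀ hf.pos).2 hf.upper⟩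

theorem marginal_div_mem_box (hc : 0 < c) (hv : v < n) (hs : IsFib c s)
    (hE : ∀ e ∈ E, 0 ≤ e.weight) : marginal n v s E / c ∈ box (1 / c ^ 2) := by
  have hp := partition_pos (n := n) hc hs hE
  have h := partition_shift_bounds hc hv hs hE
  exact (div_mem_box_iff hc).2 ⟨(le_div_iff₀ hp).2 h.1, (div_le_iff₀ hp).2 h.2⟩

theorem marginal_of_extract_eq_none (hc : 0 < c) (hv : v < n) (hs : IsFib c s)
    (hE : ∀ e ∈ E, 0 ≤ e.weight) (h : extract v E = none) :
    marginal n v s E = s v 1 / s v 0 := by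
  rw [marginal, div_eq_div_iff (partition_pos hc hs hE).ne' (hs v).pos.ne']
  exact partition_shift_of_not_incident hv (not_incident_of_extract_eq_none h) s

theorem marginal_of_extract_eq_some (hc : 0 < c) (hv : v < n) (hs : IsFib c s)
    (hE : ∀ e ∈ E, 0 ≤ e.weight) (h : extract v E = some (u, w, E')) :
    marginal n v s E = marginalStep c 1 w (marginal n v s E') (marginal n v (shift u s) E')
      (marginal n u s E') := by
  obtain ⟨hw, hE'⟩ := nonneg_of_extract hE h
  have h00 := partition_pos (n := n) hc hs hE'
  have h01 := partition_pos (n := n) hc (hs.shift hc u) hE'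
  have h11 := partition_pos (n := n) hc ((hs.shift hc u).shift hc v) hE'
  have : 0 < partition n s E' + w * partition n (shift v (shift u s)) E' := by positivity
  simp only [marginal, marginalStep]
  rw [partition_of_extract_eq_some h, partition_of_extract_eq_some h s, shift_comm u v s,
    partition_shift_shift hv E' (hs.shift hc u v).recurrence]
  field_simp

theorem truncMarginal_div_mem_box (hc : 0 < c) (l v : ℕ) (hs : IsFib c s)
    (hE : ∀ e ∈ E, 0 ≤ e.weight) : truncMarginal c l v s E / c ∈ box (1 / c ^ 2) := by
  induction l generalizing v s E with
  | zero => exact (hs v).div_mem_box hc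
  | succ l ih =>
    rw [truncMarginal]
    split
    next => exact (hs v).div_mem_box hc
    next u w E' h =>
      obtain ⟨hw, hE'⟩ := nonneg_of_extract hE h
      rw [marginalStep_div hc.ne']
      exact marginalStep_mem_box (by positivity) (by positivity) (ih v hs hE')
        (ih v (hs.shift hc u) hE') (ih u hs hE')

theorem truncMarginal_pos (hc : 0 < c) (l v : ℕ) (hs : IsFib c s) (hE : ∀ e ∈ E, 0 ≤ e.weight) :
    0 < truncMarginal c l v s E :=
  pos_of_div_mem_box hc (truncMarginal_div_mem_box hc l v hs hE)

theorem potential_dist_le {η a b : ℝ} (hη' : η ≤ 0.1515) (ha : a ∈ box η) (hb : b ∈ box η) :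
    |potential a - potential b| ≤ 11 := by
  have hbounds : ∀ r ∈ box η, 1 / 6 ≤ (r - 1 / 4) / (2 - r) ∧ (r - 1 / 4) / (2 - r) ≤ 2 := by
    intro r hr
    have : 0 < 2 - r := by linarith [hr.2]
    exact ⟨(le_div_iff₀ this).2 (by linarith [hr.1]), (div_le_iff₀ this).2 (by linarith [hr.2])⟩
  -- `log y - log x ≤ log 12 ≤ 11`
  have hlog : ∀ x y : ℝ, 1 / 6 ≤ x → y ≤ 2 → 0 < y → Real.log y - Real.log x ≤ 11 := by
    intro x y hx hy hy0
    have hx0 : 0 < x := by linarith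
    rw [← Real.log_div hy0.ne' hx0.ne']
    refine (Real.log_le_sub_one_of_pos (by positivity)).trans ?_
    rw [sub_le_iff_le_add, div_le_iff₀ hx0]
    linarith
  have ha := hbounds a ha
  have hb := hbounds b hb
  rw [abs_sub_le_iff]
  exact ⟨hlog _ _ hb.1 ha.2 (by linarith), hlog _ _ ha.1 hb.2 (by linarith)⟩

theorem abs_log_sub_log_le_abs_potential_sub {a b : ℝ} (ha : a ∈ Set.Ioo (1 / 4) 2)
    (hb : b ∈ Set.Ioo (1 / 4) 2) : |Real.log a - Real.log b| ≤ |potential a - potential b| := by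
  wlog hab : a ≤ b generalizing a b
  · rw [abs_sub_comm, abs_sub_comm (potential a)]
    exact this hb ha (le_of_not_ge hab)
  have ha0 : 0 < a := by linarith [ha.1]
  have hb0 : 0 < b := by linarith [hb.1]
  have hlog : Real.log a ≤ Real.log b := Real.log_le_log ha0 hab
  rw [abs_sub_comm, abs_of_nonneg (by linarith), abs_sub_comm]
  refine le_trans ?_ (le_abs_self _)
  have ha1 : 0 < a - 1 / 4 := sub_pos.2 ha.1
  have hb1 : 0 < b - 1 / 4 := sub_pos.2 hb.1
  have ha2 : 0 < 2 - a := sub_pos.2 ha.2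
  have hb2 : 0 < 2 - b := sub_pos.2 hb.2
  rw [potential, potential, ← Real.log_div hb0.ne' ha0.ne',
    ← Real.log_div (by positivity) (by positivity)]
  refine Real.log_le_log (by positivity) ?_
  rw [div_le_div_iff₀ (by positivity) (by positivity), div_mul_eq_mul_div, mul_div_assoc', mul_comm,
    div_le_div_iff₀ ha2 hb2]
  nlinarith [mul_nonneg (sub_nonneg.2 hab) ha1.le, mul_pos ha0 hb0,
    mul_nonneg (sub_nonneg.2 hab) (mul_pos ha0 hb0).le]

theorem potential_marginal_dist_le (hc : 2.57 ≤ c) (hlam : 0 ≤ lam) (l : ℕ) (hv : v < n)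
    (hs : IsFib c s) (hE : ∀ e ∈ E, e.Admissible n lam) :
    |potential (marginal n v s E / c) - potential (truncMarginal c l v s E / c)| ≤
      rate (lam * c ^ 2) ^ l * 11 := by
  have hc0 : 0 < c := by linarith
  have hη := one_div_sq_le hc
  have hrate := rate_pos (k := lam * c ^ 2) (by positivity)
  have hweight {E : List Edge} (hE : ∀ e ∈ E, e.Admissible n lam) : ∀ e ∈ E, 0 ≤ e.weight :=
    fun e he => hlam.trans (hE e he).le_weight
  induction l generalizing v s E with
  | zero =>
    rw [pow_zero, one_mul]
    exact potential_dist_le hη (marginal_div_mem_box hc0 hv hs (hweight hE))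
      ((hs v).div_mem_box hc0)
  | succ l ih =>
    rw [truncMarginal]
    split
    next h =>
      rw [marginal_of_extract_eq_none hc0 hv hs (hweight hE) h, sub_self, abs_zero]
      positivity
    next u w E' h =>
      obtain ⟨hu, hw, hE'⟩ := admissible_of_extract hE h
      have hs' := hs.shift hc0 u
      have hmem {v : ℕ} (hv : v < n) {s : State} (hs : IsFib c s) :=
        marginal_div_mem_box hc0 hv hs (hweight hE')
      have hmem' (v : ℕ) {s : State} (hs : IsFib c s) :=
        truncMarginal_div_mem_box hc0 l v hs (hweight hE')
      rw [marginal_of_extract_eq_some hc0 hv hs (hweight hE) h, marginalStep_div hc0.ne',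
        marginalStep_div hc0.ne', pow_succ' (rate _), mul_assoc]
      exact potential_marginalStep_dist_le (by positivity) hη (by positivity)
        (mul_le_mul_of_nonneg_right hw (by positivity)) (hmem' v hs) (hmem' v hs') (hmem' u hs)
        (hmem hv hs) (hmem hv hs') (hmem hu hs) (ih hv hs hE') (ih hv hs' hE') (ih hu hs hE')

/-- The positive numbers `a` and `b` agree up to a factor `exp δ`. -/
structure Near (δ a b : ℝ) : Prop where
  pos_left : 0 < a
  pos_right : 0 < b
  le_left : a ≤ Real.exp δ * b
  le_right : b ≤ Real.exp δ * a

theorem Near.mul {δ δ' a b a' b' : ℝ} (h : Near δ a b) (h' : Near δ' a' b') :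
    Near (δ + δ') (a * a') (b * b') := by
  have := h.pos_left
  have := h.pos_right
  refine ⟨mul_pos h.pos_left h'.pos_left, mul_pos h.pos_right h'.pos_right, ?_, ?_⟩ <;>
  rw [Real.exp_add, mul_mul_mul_comm]
  · exact mul_le_mul h.le_left h'.le_left h'.pos_left.le (by positivity)
  · exact mul_le_mul h.le_right h'.le_right h'.pos_right.le (by positivity)

theorem Near.one_add_mul {δ a b : ℝ} (h : Near δ a b) (hδ : 0 ≤ δ) (hw : 0 ≤ w) :
    Near δ (1 + w * a) (1 + w * b) := by
  have := Real.one_le_exp hδ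
  have := mul_nonneg hw h.pos_left.le
  have := mul_nonneg hw h.pos_right.le
  exact ⟨by positivity, by positivity, by nlinarith [mul_le_mul_of_nonneg_left h.le_left hw],
    by nlinarith [mul_le_mul_of_nonneg_left h.le_right hw]⟩

theorem near_of_abs_log_sub_log_le {δ a b : ℝ} (ha : 0 < a) (hb : 0 < b)
    (h : |Real.log a - Real.log b| ≤ δ) : Near δ a b := by
  rw [abs_sub_le_iff] at h
  refine ⟨ha, hb, ?_, ?_⟩
  · rw [← Real.log_le_log_iff ha (by positivity), Real.log_mul (by positivity) hb.ne', Real.log_exp]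
    linarith
  · rw [← Real.log_le_log_iff hb (by positivity), Real.log_mul (by positivity) ha.ne', Real.log_exp]
    linarith

theorem near_truncMarginal (hc : 2.57 ≤ c) (hlam : 0 ≤ lam) (l : ℕ) (hv : v < n)
    (hs : IsFib c s) (hE : ∀ e ∈ E, e.Admissible n lam) :
    Near (rate (lam * c ^ 2) ^ l * 11) (marginal n v s E) (truncMarginal c l v s E) := by
  have hc0 : 0 < c := by linarith
  have hE₀ : ∀ e ∈ E, 0 ≤ e.weight := fun e he => hlam.trans (hE e he).le_weight
  have hm := marginal_div_mem_box hc0 hv hs hE₀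
  have ht := truncMarginal_div_mem_box hc0 l v hs hE₀
  have hm0 := pos_of_div_mem_box hc0 hm
  have ht0 := pos_of_div_mem_box hc0 ht
  have hη := one_div_sq_le hc
  have hlog := abs_log_sub_log_le_abs_potential_sub (mem_Ioo_of_mem_box hη hm)
    (mem_Ioo_of_mem_box hη ht)
  rw [Real.log_div hm0.ne' hc0.ne', Real.log_div ht0.ne' hc0.ne', sub_sub_sub_cancel_right] at hlog
  exact near_of_abs_log_sub_log_le hm0 ht0
    (hlog.trans (potential_marginal_dist_le hc hlam l hv hs hE))

theorem partition_cons_eq_mul (hc : 0 < c) (hs : IsFib c s) (e : Edge)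
    (hE : ∀ e ∈ E, 0 ≤ e.weight) :
    partition n s (e :: E) = partition n s E *
      (1 + e.weight * (marginal n e.right s E * marginal n e.left (shift e.right s) E)) := by
  have := partition_pos (n := n) hc hs hE
  have := partition_pos (n := n) hc (hs.shift hc e.right) hE
  simp only [partition, marginal]
  field_simp

theorem near_approxPartition (hc : 2.57 ≤ c) (hlam : 0 ≤ lam) (l : ℕ) (hs : IsFib c s)
    (hE : ∀ e ∈ E, e.Admissible n lam) :
    Near (E.length * (2 * (rate (lam * c ^ 2) ^ l * 11))) (partition n s E)
      (approxPartition n c l s E) := by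
  have hc0 : 0 < c := by linarith
  have hrate := rate_pos (k := lam * c ^ 2) (by positivity)
  induction E with
  | nil =>
    have : 0 < ∏ x ∈ Finset.range n, s x 0 := Finset.prod_pos fun x _ => (hs x).pos
    exact ⟨this, this, by simp [partition, approxPartition], by simp [partition, approxPartition]⟩
  | cons e E ih =>
    rw [List.forall_mem_cons] at hE
    obtain ⟨he, hE⟩ := hE
    have hright := near_truncMarginal hc hlam l he.right_lt hs hE
    have hleft := near_truncMarginal hc hlam l he.left_lt (hs.shift hc0 e.right) hE
    have hfactor := (hright.mul hleft).one_add_mul (by positivity) (hlam.trans he.le_weight)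
    rw [partition_cons_eq_mul hc0 hs e fun e he => hlam.trans (hE e he).le_weight, approxPartition]
    convert (ih hE).mul hfactor using 1
    push_cast [List.length_cons]
    ring

end Marginals

/-! ### Bit lengths and cost models -/

theorem bitLength_ratCast (q : ℚ) :
    bitLength q = Nat.size q.num.natAbs + Nat.size q.den := by
  have h : IsRat (q : ℝ) := ⟨q, rfl⟩
  have h' : h.choose = q := by exact_mod_cast h.choose_spec
  rw [bitLength, dif_pos h, h']

theorem bitLength_natCast_le (k : ℕ) : bitLength k ≤ k + 1 := by
  have h := bitLength_ratCast k
  rw [Rat.cast_natCast] at h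
  simpa [h] using Nat.size_le.2 Nat.lt_two_pow_self

theorem natSize_mul_le (a b : ℕ) : Nat.size (a * b) ≤ Nat.size a + Nat.size b := by
  rw [Nat.size_le, pow_add]
  exact mul_lt_mul'' (Nat.lt_size_self a) (Nat.lt_size_self b) (Nat.zero_le _) (Nat.zero_le _)

theorem natSize_add_le (a b : ℕ) : Nat.size (a + b) ≤ max (Nat.size a) (Nat.size b) + 1 := by
  have ha := Nat.size_le.1 (le_max_left (Nat.size a) (Nat.size b))
  have hb := Nat.size_le.1 (le_max_right (Nat.size a) (Nat.size b))
  rw [Nat.size_le, pow_succ]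
  omega

theorem bitLength_divInt_le (a : ℤ) {b : ℤ} (hb : b ≠ 0) :
    bitLength (Rat.divInt a b) ≤ Nat.size a.natAbs + Nat.size b.natAbs := by
  rw [bitLength_ratCast]
  refine Nat.add_le_add (Nat.size_le_size ?_) (Nat.size_le_size ?_)
  · rcases eq_or_ne a 0 with rfl | ha
    · simp
    · exact Nat.le_of_dvd (Int.natAbs_pos.2 ha) (Int.natAbs_dvd_natAbs.2 (Rat.num_dvd a hb))
  · exact Nat.le_of_dvd (Int.natAbs_pos.2 hb) (Int.natCast_dvd.1 (Rat.den_dvd a b))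

theorem bitLength_add_le (p q : ℚ) :
    bitLength ((p + q : ℚ) : ℝ) ≤ 2 * (bitLength p + bitLength q) + 1 := by
  rw [Rat.add_num_den, bitLength_ratCast p, bitLength_ratCast q]
  refine (bitLength_divInt_le _ (by exact_mod_cast mul_ne_zero p.den_nz q.den_nz)).trans ?_
  have hnum : (p.num * q.den + p.den * q.num).natAbs.size ≤
      (p.num.natAbs * q.den + p.den * q.num.natAbs).size := by
    simpa only [Int.natAbs_mul, Int.natAbs_natCast] using
      Nat.size_le_size (Int.natAbs_add_le (p.num * q.den) (p.den * q.num))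
  have hadd := natSize_add_le (p.num.natAbs * q.den) (p.den * q.num.natAbs)
  have h₁ := natSize_mul_le p.num.natAbs q.den
  have h₂ := natSize_mul_le p.den q.num.natAbs
  have hden := natSize_mul_le p.den q.den
  simp only [Int.natAbs_mul, Int.natAbs_natCast]
  omega

theorem bitLength_neg (q : ℚ) : bitLength ((-q : ℚ) : ℝ) = bitLength q := by
  rw [bitLength_ratCast, bitLength_ratCast, Rat.num_neg_eq_neg_num, Rat.den_neg_eq_den,
    Int.natAbs_neg]

theorem bitLength_sub_le (p q : ℚ) :
    bitLength ((p - q : ℚ) : ℝ) ≤ 2 * (bitLength p + bitLength q) + 1 := by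
  simpa only [sub_eq_add_neg, bitLength_neg] using bitLength_add_le p (-q)

theorem bitLength_mul_le (p q : ℚ) :
    bitLength ((p * q : ℚ) : ℝ) ≤ bitLength p + bitLength q := by
  rw [Rat.mul_eq_mkRat, Rat.mkRat_eq_divInt, bitLength_ratCast p, bitLength_ratCast q]
  refine (bitLength_divInt_le _ (by exact_mod_cast mul_ne_zero p.den_nz q.den_nz)).trans ?_
  have hnum := natSize_mul_le p.num.natAbs q.num.natAbs
  have hden := natSize_mul_le p.den q.den
  simp only [Int.natAbs_mul, Int.natAbs_natCast]
  omega

theorem bitLength_div_le (p q : ℚ) :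
    bitLength ((p / q : ℚ) : ℝ) ≤ bitLength p + bitLength q := by
  rcases eq_or_ne q 0 with rfl | hq
  · simp only [div_zero]
    exact Nat.le_add_left _ _
  rw [Rat.div_def', bitLength_ratCast p, bitLength_ratCast q]
  have hden_ne : (p.den : ℤ) * q.num ≠ 0 :=
    mul_ne_zero (by exact_mod_cast p.den_nz) (Rat.num_ne_zero.2 hq)
  refine (bitLength_divInt_le _ hden_ne).trans ?_
  have hnum := natSize_mul_le p.num.natAbs q.den
  have hden := natSize_mul_le p.den q.num.natAbs
  simp only [Int.natAbs_mul, Int.natAbs_natCast]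
  omega

/-- On the numbers in `K`, the cost measure `w` of the result of a field operation is controlled by
that of the operands. This treats unit cost (on `ℝ`) and bit cost (on `ℚ`) at the same time. -/
structure CostModel (w : ℝ → ℕ) (K : Subfield ℝ) : Prop where
  ratCast (q : ℚ) : w q ≤ bitLength q
  add {x y : ℝ} (hx : x ∈ K) (hy : y ∈ K) : w (x + y) ≤ 2 * (w x + w y) + 1
  sub {x y : ℝ} (hx : x ∈ K) (hy : y ∈ K) : w (x - y) ≤ 2 * (w x + w y) + 1
  mul {x y : ℝ} (hx : x ∈ K) (hy : y ∈ K) : w (x * y) ≤ w x + w y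
  div {x y : ℝ} (hx : x ∈ K) (hy : y ∈ K) : w (x / y) ≤ w x + w y

theorem costModel_unitCost : CostModel unitCost ⊤ := by
  constructor <;> intros <;> exact Nat.zero_le _

theorem costModel_bitLength : CostModel bitLength (Rat.castHom ℝ).fieldRange where
  ratCast _ := le_rfl
  add := by
    rintro _ _ ⟨p, rfl⟩ ⟨q, rfl⟩
    simpa using bitLength_add_le p q
  sub := by
    rintro _ _ ⟨p, rfl⟩ ⟨q, rfl⟩
    simpa using bitLength_sub_le p q
  mul := by
    rintro _ _ ⟨p, rfl⟩ ⟨q, rfl⟩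
    simpa using bitLength_mul_le p q
  div := by
    rintro _ _ ⟨p, rfl⟩ ⟨q, rfl⟩
    simpa using bitLength_div_le p q

/-- The number `x` lies in `K` and has cost at most `S`. -/
structure FitsIn (w : ℝ → ℕ) (K : Subfield ℝ) (S : ℕ) (x : ℝ) : Prop where
  mem : x ∈ K
  le : w x ≤ S

section FitsIn

variable {w : ℝ → ℕ} {K : Subfield ℝ} {S T : ℕ} {x y : ℝ}

theorem FitsIn.mono (h : FitsIn w K S x) (hST : S ≤ T) : FitsIn w K T x := ⟨h.mem, h.le.trans hST⟩

theorem CostModel.fitsIn_ratCast (M : CostModel w K) (q : ℚ) : FitsIn w K (bitLength q) q :=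
  ⟨SubfieldClass.ratCast_mem K q, M.ratCast q⟩

theorem CostModel.fitsIn_natCast (M : CostModel w K) (k : ℕ) : FitsIn w K (k + 1) k := by
  simpa using (M.fitsIn_ratCast k).mono (by simpa using bitLength_natCast_le k)

theorem CostModel.fitsIn_zero (M : CostModel w K) : FitsIn w K 1 0 := by
  simpa using M.fitsIn_natCast 0

theorem CostModel.fitsIn_one (M : CostModel w K) : FitsIn w K 2 1 := by
  simpa using M.fitsIn_natCast 1

theorem CostModel.fitsIn_add (M : CostModel w K) (hx : FitsIn w K S x) (hy : FitsIn w K T y) :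
    FitsIn w K (2 * (S + T) + 1) (x + y) :=
  ⟨K.add_mem hx.mem hy.mem, by linarith [M.add hx.mem hy.mem, hx.le, hy.le]⟩

theorem CostModel.fitsIn_sub (M : CostModel w K) (hx : FitsIn w K S x) (hy : FitsIn w K T y) :
    FitsIn w K (2 * (S + T) + 1) (x - y) :=
  ⟨K.sub_mem hx.mem hy.mem, by linarith [M.sub hx.mem hy.mem, hx.le, hy.le]⟩

theorem CostModel.fitsIn_mul (M : CostModel w K) (hx : FitsIn w K S x) (hy : FitsIn w K T y) :
    FitsIn w K (S + T) (x * y) :=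
  ⟨K.mul_mem hx.mem hy.mem, (M.mul hx.mem hy.mem).trans (Nat.add_le_add hx.le hy.le)⟩

theorem CostModel.fitsIn_div (M : CostModel w K) (hx : FitsIn w K S x) (hy : FitsIn w K T y) :
    FitsIn w K (S + T) (x / y) :=
  ⟨K.div_mem hx.mem hy.mem, (M.div hx.mem hy.mem).trans (Nat.add_le_add hx.le hy.le)⟩

end FitsIn

/-! ### Costs of terms -/

open RealProg

/-- The term `e` evaluates to `v` at cost at most `T`. -/
def Costs (w : ℝ → ℕ) (fs : List Term) (env : List Val) (e : Term) (v : Val) (T : ℕ) : Prop :=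
  ∃ t, Eval w fs env e v t ∧ t ≤ T

/-- `s` if the numbers `a` and `b` are equal, and `t` otherwise. -/
def ifEq (a b s t : Term) : Term := .ifLe a b (.ifLe b a s t) t

namespace Costs

variable {w : ℝ → ℕ} {fs : List Term} {env : List Val} {a b e₁ e₂ body : Term} {u v p q : Val}
  {x y : ℝ} {r s t T T' i f : ℕ}

theorem mono (h : Costs w fs env a v T) (hT : T ≤ T') : Costs w fs env a v T' :=
  let ⟨t, ht, hle⟩ := h
  ⟨t, ht, hle.trans hT⟩

theorem var (h : env[i]? = some v) : Costs w fs env (.var i) v 1 := ⟨1, .var h, le_rfl⟩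

theorem const (q : ℚ) : Costs w fs env (.const q) (.num q) 1 := ⟨1, .const q, le_rfl⟩

theorem zero : Costs w fs env (.const 0) (.num 0) 1 := by simpa using const (w := w) 0

theorem one : Costs w fs env (.const 1) (.num 1) 1 := by simpa using const (w := w) 1

theorem nil : Costs w fs env .nil .nil 1 := ⟨1, .nil, le_rfl⟩

theorem cons (ha : Costs w fs env a u s) (hb : Costs w fs env b v t) :
    Costs w fs env (.cons a b) (.cons u v) (s + t + 1) := by
  obtain ⟨s', ha, hs⟩ := ha
  obtain ⟨t', hb, ht⟩ := hb
  exact ⟨_, .cons ha hb, by omega⟩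

theorem arith (o : Op) (ha : Costs w fs env a (.num x) s) (hb : Costs w fs env b (.num y) t)
    (hdiv : o = Op.div → y ≠ 0) :
    Costs w fs env (.arith o a b) (.num (o.apply x y))
      (s + t + 1 + (w x + w y + w (o.apply x y))) := by
  obtain ⟨s', ha, hs⟩ := ha
  obtain ⟨t', hb, ht⟩ := hb
  exact ⟨_, .arith ha hb hdiv, by omega⟩

theorem add (ha : Costs w fs env a (.num x) s) (hb : Costs w fs env b (.num y) t) :
    Costs w fs env (.arith .add a b) (.num (x + y)) (s + t + 1 + (w x + w y + w (x + y))) :=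
  arith .add ha hb (by simp)

theorem sub (ha : Costs w fs env a (.num x) s) (hb : Costs w fs env b (.num y) t) :
    Costs w fs env (.arith .sub a b) (.num (x - y)) (s + t + 1 + (w x + w y + w (x - y))) :=
  arith .sub ha hb (by simp)

theorem mul (ha : Costs w fs env a (.num x) s) (hb : Costs w fs env b (.num y) t) :
    Costs w fs env (.arith .mul a b) (.num (x * y)) (s + t + 1 + (w x + w y + w (x * y))) :=
  arith .mul ha hb (by simp)

theorem div (ha : Costs w fs env a (.num x) s) (hb : Costs w fs env b (.num y) t) (hy : y ≠ 0) :
    Costs w fs env (.arith .div a b) (.num (x / y)) (s + t + 1 + (w x + w y + w (x / y))) :=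
  arith .div ha hb fun _ => hy

theorem bind (ha : Costs w fs env a u s) (hb : Costs w fs (u :: env) b v t) :
    Costs w fs env (.bind a b) v (s + t + 1) := by
  obtain ⟨s', ha, hs⟩ := ha
  obtain ⟨t', hb, ht⟩ := hb
  exact ⟨_, .bind ha hb, by omega⟩

theorem ifLe_true (ha : Costs w fs env a (.num x) r) (hb : Costs w fs env b (.num y) s)
    (hxy : x ≤ y) (he : Costs w fs env e₁ v t) :
    Costs w fs env (.ifLe a b e₁ e₂) v (r + s + t + 1 + (w x + w y)) := by
  obtain ⟨r', ha, hr⟩ := ha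
  obtain ⟨s', hb, hs⟩ := hb
  obtain ⟨t', he, ht⟩ := he
  exact ⟨_, .ifLe_true ha hb hxy he, by omega⟩

theorem ifLe_false (ha : Costs w fs env a (.num x) r) (hb : Costs w fs env b (.num y) s)
    (hxy : ¬ x ≤ y) (he : Costs w fs env e₂ v t) :
    Costs w fs env (.ifLe a b e₁ e₂) v (r + s + t + 1 + (w x + w y)) := by
  obtain ⟨r', ha, hr⟩ := ha
  obtain ⟨s', hb, hs⟩ := hb
  obtain ⟨t', he, ht⟩ := he
  exact ⟨_, .ifLe_false ha hb hxy he, by omega⟩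

theorem split_nil (ha : Costs w fs env a .nil s) (he : Costs w fs env e₁ v t) :
    Costs w fs env (.split a e₁ e₂) v (s + t + 1) := by
  obtain ⟨s', ha, hs⟩ := ha
  obtain ⟨t', he, ht⟩ := he
  exact ⟨_, .split_nil ha he, by omega⟩

theorem split_cons (ha : Costs w fs env a (.cons p q) s)
    (he : Costs w fs (p :: q :: env) e₂ v t) :
    Costs w fs env (.split a e₁ e₂) v (s + t + 1) := by
  obtain ⟨s', ha, hs⟩ := ha
  obtain ⟨t', he, ht⟩ := he
  exact ⟨_, .split_cons ha he, by omega⟩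

theorem call (hf : fs[f]? = some body) (ha : Costs w fs env a u s)
    (hb : Costs w fs [u] body v t) : Costs w fs env (.call f a) v (s + t + 1) := by
  obtain ⟨s', ha, hs⟩ := ha
  obtain ⟨t', hb, ht⟩ := hb
  exact ⟨_, .call hf ha hb, by omega⟩

theorem ifEq_true (ha : Costs w fs env a (.num x) r) (hb : Costs w fs env b (.num x) s)
    (he : Costs w fs env e₁ v t) :
    Costs w fs env (ifEq a b e₁ e₂) v (2 * (r + s + 1 + (w x + w x)) + t) :=
  (ifLe_true ha hb le_rfl (ifLe_true hb ha le_rfl he)).mono (by omega)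

theorem ifEq_false (ha : Costs w fs env a (.num x) r) (hb : Costs w fs env b (.num y) s)
    (hxy : x ≠ y) (he : Costs w fs env e₂ v t) :
    Costs w fs env (ifEq a b e₁ e₂) v (2 * (r + s + 1 + (w x + w y)) + t) := by
  by_cases h : x ≤ y
  · exact (ifLe_true ha hb h (ifLe_false hb ha (not_le.2 (h.lt_of_ne hxy)) he)).mono (by omega)
  · exact (ifLe_false ha hb h he).mono (by omega)

end Costs

/-- The term `e` evaluates at cost at most `T` to the number `x`, which fits in `S`. -/
structure Computes (w : ℝ → ℕ) (K : Subfield ℝ) (fs : List Term) (env : List Val) (e : Term)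
    (x : ℝ) (S T : ℕ) : Prop where
  costs : Costs w fs env e (.num x) T
  fitsIn : FitsIn w K S x

section Computes

variable {w : ℝ → ℕ} {K : Subfield ℝ} {fs : List Term} {env : List Val} {a b e₁ e₂ : Term}
  {u v : Val} {x y : ℝ} {R S T s t i k : ℕ}

theorem Computes.var (h : env[i]? = some (.num x)) (hx : FitsIn w K S x) :
    Computes w K fs env (.var i) x S 1 :=
  ⟨.var h, hx⟩

theorem Computes.mono (h : Computes w K fs env a x S s) (hST : S ≤ T) (hst : s ≤ t) :
    Computes w K fs env a x T t :=
  ⟨h.costs.mono hst, h.fitsIn.mono hST⟩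

theorem Computes.bind (ha : Costs w fs env a v s) (hb : Computes w K fs (v :: env) b x S t) :
    Computes w K fs env (.bind a b) x S (s + t + 1) :=
  ⟨.bind ha hb.costs, hb.fitsIn⟩

theorem Computes.split_nil (ha : Costs w fs env a .nil s) (he : Computes w K fs env e₁ x S t) :
    Computes w K fs env (.split a e₁ e₂) x S (s + t + 1) :=
  ⟨.split_nil ha he.costs, he.fitsIn⟩

theorem Computes.split_cons (ha : Costs w fs env a (.cons u v) s)
    (he : Computes w K fs (u :: v :: env) e₂ x S t) :
    Computes w K fs env (.split a e₁ e₂) x S (s + t + 1) :=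
  ⟨.split_cons ha he.costs, he.fitsIn⟩

theorem Computes.call (hf : fs[i]? = some b) (ha : Costs w fs env a v s)
    (hb : Computes w K fs [v] b x S t) : Computes w K fs env (.call i a) x S (s + t + 1) :=
  ⟨.call hf ha hb.costs, hb.fitsIn⟩

theorem CostModel.computes_one (M : CostModel w K) : Computes w K fs env (.const 1) 1 2 1 :=
  ⟨.one, M.fitsIn_one⟩

theorem CostModel.computes_add (M : CostModel w K) (ha : Computes w K fs env a x S s)
    (hb : Computes w K fs env b y T t) :
    Computes w K fs env (.arith .add a b) (x + y) (2 * (S + T) + 1) (s + t + 3 * (S + T) + 2) :=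
  have h := M.fitsIn_add ha.fitsIn hb.fitsIn
  ⟨(ha.costs.add hb.costs).mono (by linarith [ha.fitsIn.le, hb.fitsIn.le, h.le]), h⟩

theorem CostModel.computes_sub (M : CostModel w K) (ha : Computes w K fs env a x S s)
    (hb : Computes w K fs env b y T t) :
    Computes w K fs env (.arith .sub a b) (x - y) (2 * (S + T) + 1) (s + t + 3 * (S + T) + 2) :=
  have h := M.fitsIn_sub ha.fitsIn hb.fitsIn
  ⟨(ha.costs.sub hb.costs).mono (by linarith [ha.fitsIn.le, hb.fitsIn.le, h.le]), h⟩

theorem CostModel.computes_mul (M : CostModel w K) (ha : Computes w K fs env a x S s)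
    (hb : Computes w K fs env b y T t) :
    Computes w K fs env (.arith .mul a b) (x * y) (S + T) (s + t + 2 * (S + T) + 1) :=
  have h := M.fitsIn_mul ha.fitsIn hb.fitsIn
  ⟨(ha.costs.mul hb.costs).mono (by linarith [ha.fitsIn.le, hb.fitsIn.le, h.le]), h⟩

theorem CostModel.computes_div (M : CostModel w K) (ha : Computes w K fs env a x S s)
    (hb : Computes w K fs env b y T t) (hy : y ≠ 0) :
    Computes w K fs env (.arith .div a b) (x / y) (S + T) (s + t + 2 * (S + T) + 1) :=
  have h := M.fitsIn_div ha.fitsIn hb.fitsIn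
  ⟨(ha.costs.div hb.costs hy).mono (by linarith [ha.fitsIn.le, hb.fitsIn.le, h.le]), h⟩

theorem CostModel.costs_pred (M : CostModel w K)
    (ha : Costs w fs env a (.num ((k + 1 : ℕ) : ℝ)) s) :
    Costs w fs env (.arith .sub a (.const 1)) (.num k) (s + 2 * k + 7) := by
  have h := ha.sub .one
  have hk : ((k + 1 : ℕ) : ℝ) - 1 = k := by push_cast; ring
  rw [hk] at h
  have h₁ := M.fitsIn_one.le
  have h₂ := (M.fitsIn_natCast k).le
  have h₃ := (M.fitsIn_natCast (k + 1)).le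
  exact h.mono (by omega)

theorem CostModel.costs_ifLe_zero (M : CostModel w K)
    (ha : Costs w fs env a (.num ((0 : ℕ) : ℝ)) s) (he : Costs w fs env e₁ v t) :
    Costs w fs env (.ifLe a (.const 0) e₁ e₂) v (s + t + 4) := by
  rw [Nat.cast_zero] at ha
  exact (ha.ifLe_true .zero le_rfl he).mono (by linarith [M.fitsIn_zero.le])

theorem CostModel.costs_ifLe_succ (M : CostModel w K)
    (ha : Costs w fs env a (.num ((k + 1 : ℕ) : ℝ)) s) (he : Costs w fs env e₂ v t) :
    Costs w fs env (.ifLe a (.const 0) e₁ e₂) v (s + t + k + 5) := by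
  have h : ¬ ((k + 1 : ℕ) : ℝ) ≤ 0 := not_le.2 (by positivity)
  have h₁ := M.fitsIn_zero.le
  have h₂ := (M.fitsIn_natCast (k + 1)).le
  exact (ha.ifLe_false .zero h he).mono (by omega)

end Computes

/-! ### The program -/

/-- The position of `fuelTerm` among the functions of the program. -/
abbrev fuelIndex : ℕ := 0

/-- The position of `tailTerm` among the functions of the program. -/
abbrev tailIndex : ℕ := 1

/-- The position of `getTerm` among the functions of the program. -/
abbrev getIndex : ℕ := 2

/-- The position of `extractTerm` among the functions of the program. -/
abbrev extractIndex : ℕ := 3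

/-- The position of `firstRatioTerm` among the functions of the program. -/
abbrev firstRatioIndex : ℕ := 4

/-- The position of `stepTerm` among the functions of the program. -/
abbrev stepIndex : ℕ := 5

/-- The position of `ratioTerm` among the functions of the program. -/
abbrev ratioIndex : ℕ := 6

/-- The position of `countTerm` among the functions of the program. -/
abbrev countIndex : ℕ := 7

/-- The position of `headsTerm` among the functions of the program. -/
abbrev headsIndex : ℕ := 8

/-- The position of `approxTerm` among the functions of the program. -/
abbrev approxIndex : ℕ := 9

/-- Argument `y`: a list of empty lists, whose length is the least `l` with `1 ≤ y * β ^ l`. -/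
def fuelTerm (β : ℚ) : Term :=
  .ifLe (.const 1) (.var 0) .nil
    (.cons .nil (.call fuelIndex (.arith .mul (.var 0) (.const β))))

/-- Argument `(v . sigs)`: the vertex functions with the first value of the one at `v` removed. -/
def tailTerm : Term :=
  .split (.var 0) .nil (.split (.var 1) .nil (.ifLe (.var 2) (.const 0)
    (.cons (.split (.var 0) .nil (.var 1)) (.var 1))
    (.cons (.var 0) (.call tailIndex (.cons (.arith .sub (.var 2) (.const 1)) (.var 1))))))

/-- Argument `(v . sigs)`: the vertex function at `v`. -/
def getTerm : Term :=
  .split (.var 0) .nil (.split (.var 1) .nil (.ifLe (.var 2) (.const 0) (.var 0)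
    (.call getIndex (.cons (.arith .sub (.var 2) (.const 1)) (.var 1)))))

/-- Argument `(v . edges)`: the result of `extract`. -/
def extractTerm : Term :=
  .split (.var 0) .nil (.split (.var 1) .nil (.split (.var 0) .nil (.split (.var 0) .nil
    -- The environment is `left, right, _, weight, _, edges, v, …`.
    (ifEq (.var 0) (.var 6) (.cons (.cons (.var 1) (.var 3)) (.var 5))
      (ifEq (.var 1) (.var 6) (.cons (.cons (.var 0) (.var 3)) (.var 5))
        (.split (.call extractIndex (.cons (.var 6) (.var 5))) .nil
          (.cons (.var 0) (.cons (.var 6) (.var 1)))))))))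

/-- Argument `(f₀ . (f₁ . _))`: the quotient `f₁ / f₀`. -/
def firstRatioTerm : Term :=
  .split (.var 0) .nil (.split (.var 1) .nil (.arith .div (.var 0) (.var 2)))

/-- The number `marginalStep c 1 y a b β` in the environment
`y * β, β, b, a, _, y, _, f₂, _, f₁, _, f₀, …`. The real number `c` cannot occur in the program, but
it is `(f₂ - f₀) / f₁` by the recurrence. -/
def stepQuotientTerm : Term :=
  .arith .div
    (.arith .add (.var 3) (.arith .mul (.var 0) (.arith .add (.arith .mul
      (.arith .div (.arith .sub (.var 7) (.var 11)) (.var 9)) (.var 2)) (.const 1))))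
    (.arith .add (.const 1) (.arith .mul (.var 0) (.var 2)))

/-- Argument `((f₀ . (f₁ . (f₂ . _))) . (y . (a . (β . b))))`: the number
`marginalStep c 1 y a b β`. -/
def stepTerm : Term :=
  .split (.var 0) .nil (.split (.var 0) .nil (.split (.var 1) .nil (.split (.var 1) .nil
    (.split (.var 7) .nil (.split (.var 1) .nil (.split (.var 1) .nil
      (.bind (.arith .mul (.var 4) (.var 0)) stepQuotientTerm)))))))

/-- Argument `(fuel . (v . (sigs . edges)))`: the number `truncMarginal`. -/
def ratioTerm : Term :=
  .split (.var 0) .nil (.split (.var 1) .nil (.split (.var 1) .nil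
    (.bind (.call getIndex (.cons (.var 2) (.var 0)))
      (.split (.var 5) (.call firstRatioIndex (.var 0))
        (.split (.call extractIndex (.cons (.var 5) (.var 4))) (.call firstRatioIndex (.var 2))
          (.split (.var 0) .nil
            -- The environment is `u, weight, _, edges, _, fuel, sig, sigs, _, v, …`.
            (.call stepIndex (.cons (.var 6) (.cons (.var 1) (.cons
              (.call ratioIndex (.cons (.var 5) (.cons (.var 9) (.cons (.var 7) (.var 3)))))
              (.cons
                (.call ratioIndex (.cons (.var 5) (.cons (.var 0) (.cons (.var 7) (.var 3)))))
                (.call ratioIndex (.cons (.var 5) (.cons (.var 9)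
                  (.cons (.call tailIndex (.cons (.var 0) (.var 7))) (.var 3))))))))))))))))

/-- Argument `edges`: their number plus one. -/
def countTerm : Term :=
  .split (.var 0) (.const 1) (.arith .add (.const 1) (.call countIndex (.var 1)))

/-- Argument `sigs`: the product of the first values. -/
def headsTerm : Term :=
  .split (.var 0) (.const 1)
    (.split (.var 0) .nil (.arith .mul (.var 0) (.call headsIndex (.var 3))))

/-- Argument `(fuel . (sigs . edges))`: the number `approxPartition`. -/
def approxTerm : Term :=
  .split (.var 0) .nil (.split (.var 1) .nil (.split (.var 1) (.call headsIndex (.var 0))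
    (.split (.var 0) .nil (.split (.var 0) .nil
      -- The environment is `left, right, _, weight, _, edges, sigs, _, fuel, …`.
      (.arith .mul (.call approxIndex (.cons (.var 8) (.cons (.var 6) (.var 5))))
        (.arith .add (.const 1) (.arith .mul (.var 3) (.arith .mul
          (.call ratioIndex (.cons (.var 8) (.cons (.var 1) (.cons (.var 6) (.var 5)))))
          (.call ratioIndex (.cons (.var 8) (.cons (.var 0)
            (.cons (.call tailIndex (.cons (.var 1) (.var 6))) (.var 5)))))))))))))

/-- A bound for the powers of the contraction rate at which the recursion may stop, for relative
error `ε` on a graph with `m` edges. -/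
noncomputable def tolerance (ε : ℝ) (m : ℕ) : ℝ := 1 / 22 * (ε / (1 + ε) / (m + 1))

/-- The number `tolerance ε m` in the environment `_, edges, ε, …`, where `m` is the number of
edges. -/
def toleranceTerm : Term :=
  .arith .mul (.const (1 / 22)) (.arith .div
    (.arith .div (.var 2) (.arith .add (.const 1) (.var 2))) (.call countIndex (.var 1)))

/-- The functions of the program. -/
def functions (β : ℚ) : List Term :=
  [fuelTerm β, tailTerm, getTerm, extractTerm, firstRatioTerm, stepTerm, ratioTerm, countTerm,
    headsTerm, approxTerm]

/-- The approximation scheme. It answers `0` if the first value of some vertex function is `0`;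
otherwise it evaluates `approxPartition` at the least depth `l` with `1 ≤ tolerance ε m * β ^ l`,
where `m` is the number of edges. -/
def program (β : ℚ) : Program where
  funs := functions β
  main := .split (.var 0) .nil (.split (.var 1) .nil
    -- The environment is `sigs, edges, ε, …`.
    (.ifLe (.call headsIndex (.var 0)) (.const 0) (.const 0)
      (.call approxIndex (.cons (.call fuelIndex toleranceTerm) (.cons (.var 0) (.var 1))))))

/-! ### Encodings -/

/-- The tuple `(f 0, …, f (n - 1))` as a list of data. -/
def encodeTuple : ℕ → (ℕ → Val) → Val
  | 0, _ => .nil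
  | n + 1, f => .cons (f 0) (encodeTuple n fun i => f (i + 1))

/-- The first `k v` values of the vertex function at `v`, for each vertex `v` among
`0, …, n - 1`. -/
def encodeState (n : ℕ) (k : ℕ → ℕ) (s : State) : Val :=
  encodeTuple n fun v => encodeTuple (k v) fun i => .num (s v i)

/-- An edge in the format of `HolantInstance.encode`. -/
noncomputable def encodeEdge (e : Edge) : Val :=
  .cons (.cons (.num e.left) (.num e.right)) (.num e.weight)

/-- A list of edges in the format of `HolantInstance.encode`. -/
noncomputable def encodeEdges (E : List Edge) : Val := .ofList (E.map encodeEdge)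

/-- A recursion depth, in unary. -/
def encodeFuel (l : ℕ) : Val := encodeTuple l fun _ => .nil

/-- The result of `extract`. -/
noncomputable def encodeExtract : Option (ℕ × ℝ × List Edge) → Val
  | none => .nil
  | some (u, w, E) => .cons (.cons (.num u) (.num w)) (encodeEdges E)

/-- The numbers of recorded values of the vertex functions, after the first value at `v` has been
removed. -/
def dropAt (v : ℕ) (k : ℕ → ℕ) : ℕ → ℕ := fun x => k x - if x = v then 1 else 0

/-- The input of the program, in the format of `HolantInstance.encode`. -/
noncomputable def encodeInput (ε : ℝ) (n : ℕ) (k : ℕ → ℕ) (s : State) (E : List Edge) : Val :=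
  .cons (.num ε) (.cons (encodeState n k s) (encodeEdges E))

/-! ### Cost of the list functions -/

section ListFunctions

variable {w : ℝ → ℕ} {K : Subfield ℝ} {β : ℚ} {n S : ℕ} {k : ℕ → ℕ} {s : State} {E : List Edge}

theorem costs_get (M : CostModel w K) {v : ℕ} (hv : v < n) (f : ℕ → Val) :
    Costs w (functions β) [.cons (.num v) (encodeTuple n f)] getTerm (f v) (20 * (v + 1) ^ 2) := by
  obtain ⟨n, rfl⟩ := Nat.exists_eq_add_one_of_ne_zero (Nat.ne_zero_of_lt hv)
  induction v generalizing n f with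
  | zero =>
    exact (Costs.split_cons (.var rfl) (.split_cons (.var rfl)
      (M.costs_ifLe_zero (.var rfl) (.var rfl)))).mono (by omega)
  | succ v ih =>
    obtain ⟨n, rfl⟩ := Nat.exists_eq_add_one_of_ne_zero (show n ≠ 0 by omega)
    have hrec := ih (fun i => f (i + 1)) n (by omega)
    refine (Costs.split_cons (.var rfl) (.split_cons (.var rfl) (M.costs_ifLe_succ (.var rfl)
      (.call rfl (.cons (M.costs_pred (.var rfl)) (.var rfl)) hrec)))).mono ?_
    linarith [sq (v + 1), sq (v + 1 + 1)]

theorem encodeState_dropAt_zero (n : ℕ) (k : ℕ → ℕ) (s : State) :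
    encodeState (n + 1) (dropAt 0 k) (shift 0 s) =
      .cons (encodeTuple (k 0 - 1) fun i => .num (s 0 (i + 1)))
        (encodeState n (fun x => k (x + 1)) fun x => s (x + 1)) := by
  simp [encodeState, encodeTuple, dropAt, shift]

theorem encodeState_dropAt_succ (n v : ℕ) (k : ℕ → ℕ) (s : State) :
    encodeState (n + 1) (dropAt (v + 1) k) (shift (v + 1) s) =
      .cons (encodeTuple (k 0) fun i => .num (s 0 i))
        (encodeState n (dropAt v fun x => k (x + 1)) (shift v fun x => s (x + 1))) := by
  simp [encodeState, encodeTuple, dropAt, shift]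

theorem costs_split_tail {fs : List Term} {env : List Val} {i m : ℕ} {f : ℕ → Val}
    (h : env[i]? = some (encodeTuple m f)) :
    Costs w fs env (.split (.var i) .nil (.var 1)) (encodeTuple (m - 1) fun i => f (i + 1)) 3 := by
  rcases m with _ | m
  · exact .split_nil (.var h) .nil
  · exact .split_cons (.var h) (.var rfl)

theorem costs_tail (M : CostModel w K) {v : ℕ} (hv : v < n) (k : ℕ → ℕ) (s : State) :
    Costs w (functions β) [.cons (.num v) (encodeState n k s)] tailTerm
      (encodeState n (dropAt v k) (shift v s)) (20 * (v + 1) ^ 2) := by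
  obtain ⟨n, rfl⟩ := Nat.exists_eq_add_one_of_ne_zero (Nat.ne_zero_of_lt hv)
  induction v generalizing n k s with
  | zero =>
    rw [encodeState_dropAt_zero]
    exact (Costs.split_cons (.var rfl) (.split_cons (.var rfl) (M.costs_ifLe_zero (.var rfl)
      (.cons (costs_split_tail (m := k 0) (f := fun i => .num (s 0 i)) rfl) (.var rfl))))).mono
        (by omega)
  | succ v ih =>
    obtain ⟨n, rfl⟩ := Nat.exists_eq_add_one_of_ne_zero (show n ≠ 0 by omega)
    have hrec := ih (fun x => k (x + 1)) (fun x => s (x + 1)) n (by omega)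
    rw [encodeState_dropAt_succ]
    refine (Costs.split_cons (.var rfl) (.split_cons (.var rfl) (M.costs_ifLe_succ (.var rfl)
      (.cons (.var rfl)
        (.call rfl (.cons (M.costs_pred (.var rfl)) (.var rfl)) hrec))))).mono ?_
    linarith [sq (v + 1), sq (v + 1 + 1)]

theorem costs_extract (M : CostModel w K) {v : ℕ} (hv : v ≤ S)
    (hE : ∀ e ∈ E, e.left ≤ S ∧ e.right ≤ S) :
    Costs w (functions β) [.cons (.num v) (encodeEdges E)] extractTerm
      (encodeExtract (extract v E)) ((8 * S + 70) * (E.length + 1)) := by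
  induction E with
  | nil =>
    exact (Costs.split_cons (.var rfl) (.split_nil (.var rfl) .nil)).mono
      (by rw [List.length_nil]; omega)
  | cons e E ih =>
    obtain ⟨⟨hl, hr⟩, hE⟩ := List.forall_mem_cons.1 hE
    have hwv := ((M.fitsIn_natCast v).mono (Nat.succ_le_succ hv)).le
    have hwl := ((M.fitsIn_natCast e.left).mono (Nat.succ_le_succ hl)).le
    have hwr := ((M.fitsIn_natCast e.right).mono (Nat.succ_le_succ hr)).le
    suffices h : Costs w (functions β) [.num e.left, .num e.right,
        .cons (.num e.left) (.num e.right), .num e.weight, encodeEdge e, encodeEdges E, .num v,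
        encodeEdges (e :: E), .cons (.num v) (encodeEdges (e :: E))]
        (ifEq (.var 0) (.var 6) (.cons (.cons (.var 1) (.var 3)) (.var 5))
          (ifEq (.var 1) (.var 6) (.cons (.cons (.var 0) (.var 3)) (.var 5))
            (.split (.call extractIndex (.cons (.var 6) (.var 5))) .nil
              (.cons (.var 0) (.cons (.var 6) (.var 1))))))
        (encodeExtract (extract v (e :: E))) ((8 * S + 70) * (E.length + 1) + 8 * S + 50) from
      (Costs.split_cons (.var rfl) (.split_cons (.var rfl) (.split_cons (.var rfl)
        (.split_cons (.var rfl) h)))).mono (by rw [List.length_cons]; linarith)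
    rw [extract]
    split_ifs with hlv hrv
    · subst hlv
      exact (Costs.ifEq_true (.var rfl) (.var rfl)
        (.cons (.cons (.var rfl) (.var rfl)) (.var rfl))).mono (by nlinarith)
    · subst hrv
      exact (Costs.ifEq_false (.var rfl) (.var rfl) (by exact_mod_cast hlv)
        (.ifEq_true (.var rfl) (.var rfl)
          (.cons (.cons (.var rfl) (.var rfl)) (.var rfl)))).mono (by nlinarith)
    · have hrec := ih hE
      refine (Costs.ifEq_false (.var rfl) (.var rfl) (by exact_mod_cast hlv)
        (.ifEq_false (.var rfl) (.var rfl) (by exact_mod_cast hrv)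
          (t := (8 * S + 70) * (E.length + 1) + 14) ?_)).mono (by linarith)
      rcases h : extract v E with _ | ⟨u, y, E'⟩ <;> rw [h] at hrec
      · exact (Costs.split_nil (.call rfl (.cons (.var rfl) (.var rfl)) hrec) .nil).mono (by omega)
      · exact (Costs.split_cons (.call rfl (.cons (.var rfl) (.var rfl)) hrec)
          (.cons (.var rfl) (.cons (.var rfl) (.var rfl)))).mono (by omega)

end ListFunctions

/-! ### Cost of the truncated recursion -/

/-- The number of ends of `e` that lie at the vertex `x`. -/
def Edge.endsAt (e : Edge) (x : ℕ) : ℕ :=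
  (if e.left = x then 1 else 0) + if e.right = x then 1 else 0

/-- The degree of the vertex `x`. -/
def degree (E : List Edge) (x : ℕ) : ℕ := (E.map (·.endsAt x)).sum

/-- All integers and real numbers in the arguments of the program are bounded in terms of `S`, and
more values of the vertex functions are recorded than there are edge ends at the vertex. -/
structure InputFits (w : ℝ → ℕ) (K : Subfield ℝ) (S n : ℕ) (k : ℕ → ℕ) (s : State)
    (E : List Edge) : Prop where
  vertices_le : n ≤ S
  edges_le : E.length ≤ S
  admissible : ∀ e ∈ E, e.Admissible n 0
  fitsIn_weight : ∀ e ∈ E, FitsIn w K S e.weight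
  fitsIn_value : ∀ v < n, ∀ i < k v, FitsIn w K S (s v i)
  degree_lt : ∀ v < n, degree E v < k v

section Ratio

variable {w : ℝ → ℕ} {K : Subfield ℝ} {β : ℚ} {n S u v : ℕ} {k : ℕ → ℕ} {s : State}
  {E E' : List Edge} {c y : ℝ}

theorem degree_cons (e : Edge) (E : List Edge) (x : ℕ) :
    degree (e :: E) x = e.endsAt x + degree E x := by
  simp [degree]

theorem degree_of_extract_eq_some (h : extract v E = some (u, y, E')) (x : ℕ) :
    degree E x = (if v = x then 1 else 0) + (if u = x then 1 else 0) + degree E' x := by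
  rcases extract_perm h with h | h
  · exact (h.map _).sum_nat.trans (degree_cons _ _ _)
  · rw [add_comm (if v = x then 1 else 0)]
    exact (h.map _).sum_nat.trans (degree_cons _ _ _)

theorem InputFits.ends_le (h : InputFits w K S n k s E) :
    ∀ e ∈ E, e.left ≤ S ∧ e.right ≤ S := fun e he =>
  ⟨(h.admissible e he).left_lt.le.trans h.vertices_le,
    (h.admissible e he).right_lt.le.trans h.vertices_le⟩

theorem InputFits.succ_sq_le (h : InputFits w K S n k s E) (hv : v < n) :
    (v + 1) ^ 2 ≤ (S + 1) ^ 2 :=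
  Nat.pow_le_pow_left (Nat.succ_le_succ (hv.le.trans h.vertices_le)) 2

theorem InputFits.of_extract (h : InputFits w K S n k s E)
    (hext : extract v E = some (u, y, E')) :
    InputFits w K S n k s E' ∧ FitsIn w K S y := by
  obtain ⟨hy, hE'⟩ := forall_mem_of_extract h.fitsIn_weight hext
  have hlen : E.length = E'.length + 1 := by
    rcases extract_perm hext with h | h <;> exact h.length_eq
  refine ⟨⟨h.vertices_le, by linarith [h.edges_le], (admissible_of_extract h.admissible hext).2.2,
    hE', h.fitsIn_value, fun x hx => ?_⟩, hy.elim id id⟩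
  have := h.degree_lt x hx
  have := degree_of_extract_eq_some hext x
  omega

theorem InputFits.shift (h : InputFits w K S n k s E) (hu : degree E u + 1 < k u) :
    InputFits w K S n (dropAt u k) (shift u s) E where
  vertices_le := h.vertices_le
  edges_le := h.edges_le
  admissible := h.admissible
  fitsIn_weight := h.fitsIn_weight
  fitsIn_value v hv i hi := h.fitsIn_value v hv _ (by rw [dropAt] at hi; omega)
  degree_lt v hv := by
    have := h.degree_lt v hv
    rw [dropAt]
    split_ifs with hvu
    · subst hvu
      omega
    · exact this

theorem computes_firstRatio (M : CostModel w K) {m : ℕ} {f : ℕ → ℝ} (hm : 1 < m)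
    (hf : ∀ i < m, FitsIn w K S (f i)) (h0 : f 0 ≠ 0) :
    Computes w K (functions β) [encodeTuple m fun i => .num (f i)] firstRatioTerm (f 1 / f 0)
      (2 * S) (4 * S + 7) := by
  obtain ⟨m, rfl⟩ := Nat.exists_eq_add_of_lt hm
  rw [show 1 + m + 1 = m + 1 + 1 by ring]
  have hdiv {env : List Val} (h₁ : env[0]? = some (.num (f 1)))
      (h₀ : env[2]? = some (.num (f 0))) :=
    M.computes_div (fs := functions β) (.var h₁ (hf 1 hm)) (.var h₀ (hf 0 (by omega))) h0
  exact (Computes.split_cons (.var rfl) (.split_cons (.var rfl) (hdiv rfl rfl))).mono (by omega)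
    (by omega)

theorem computes_stepQuotient (M : CostModel w K) {env : List Val} {Y : ℕ}
    {c y a b r f₀ f₁ f₂ : ℝ} (hSY : S < Y) (hf₀ : FitsIn w K S f₀) (hf₁ : FitsIn w K S f₁)
    (hf₂ : FitsIn w K S f₂) (hyr : FitsIn w K (S + Y) (y * r)) (ha : FitsIn w K Y a)
    (hb : FitsIn w K Y b)
    (hrec : f₂ = c * f₁ + f₀) (h1 : f₁ ≠ 0) (hden : 1 + y * r * b ≠ 0)
    (henv_yr : env[0]? = some (.num (y * r))) (henv_b : env[2]? = some (.num b))
    (henv_a : env[3]? = some (.num a)) (henv_f₂ : env[7]? = some (.num f₂))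
    (henv_f₁ : env[9]? = some (.num f₁)) (henv_f₀ : env[11]? = some (.num f₀)) :
    Computes w K (functions β) env stepQuotientTerm (marginalStep c 1 y a b r)
      (36 * Y) (300 * Y) := by
  have hc : c = (f₂ - f₀) / f₁ := by rw [hrec, add_sub_cancel_right, mul_div_cancel_right₀ _ h1]
  have h := M.computes_div (fs := functions β)
    (M.computes_add (.var henv_a ha) (M.computes_mul (.var henv_yr hyr)
      (M.computes_add (M.computes_mul (M.computes_div (M.computes_sub (.var henv_f₂ hf₂)
        (.var henv_f₀ hf₀)) (.var henv_f₁ hf₁) h1) (.var henv_b hb)) M.computes_one)))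
    (M.computes_add M.computes_one (M.computes_mul (.var henv_yr hyr) (.var henv_b hb))) hden
  rw [← hc] at h
  exact ⟨h.costs.mono (by omega), h.fitsIn.mono (by omega)⟩

theorem computes_step (M : CostModel w K) {m Y : ℕ} {f : ℕ → ℝ} {c y a b r : ℝ} (hm : 2 < m)
    (hSY : S < Y) (hf : ∀ i < m, FitsIn w K S (f i)) (hy : FitsIn w K S y) (ha : FitsIn w K Y a)
    (hb : FitsIn w K Y b) (hr : FitsIn w K Y r) (hrec : f 2 = c * f 1 + f 0) (h1 : f 1 ≠ 0)
    (hden : 1 + y * r * b ≠ 0) :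
    Computes w K (functions β) [.cons (encodeTuple m fun i => .num (f i))
      (.cons (.num y) (.cons (.num a) (.cons (.num r) (.num b))))] stepTerm
      (marginalStep c 1 y a b r) (36 * Y) (400 * Y) := by
  obtain ⟨m, rfl⟩ := Nat.exists_eq_add_of_lt hm
  rw [show 2 + m + 1 = m + 1 + 1 + 1 by ring]
  have hyr {env : List Val} (h₄ : env[4]? = some (.num y)) (h₀ : env[0]? = some (.num r)) :=
    M.computes_mul (fs := functions β) (.var h₄ hy) (.var h₀ hr)
  exact (Computes.split_cons (.var rfl) (.split_cons (.var rfl) (.split_cons (.var rfl)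
    (.split_cons (.var rfl) (.split_cons (.var rfl) (.split_cons (.var rfl)
      (.split_cons (.var rfl) (.bind (hyr rfl rfl).costs
        (computes_stepQuotient M hSY (hf 0 (by omega)) (hf 1 (by omega)) (hf 2 hm)
          (M.fitsIn_mul hy hr) ha hb hrec h1 hden rfl rfl rfl rfl rfl rfl))))))))).mono le_rfl
            (by omega)

/-- The argument of `ratioTerm`. -/
noncomputable def encodeRatioInput (n l v : ℕ) (k : ℕ → ℕ) (s : State) (E : List Edge) : Val :=
  .cons (encodeFuel l) (.cons (.num v) (.cons (encodeState n k s) (encodeEdges E)))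

theorem computes_ratio_zero (M : CostModel w K) (h : InputFits w K S n k s E) (hs : IsFib c s)
    (hv : v < n) (hk : degree E v + 1 < k v) :
    Computes w K (functions β) [encodeRatioInput n 0 v k s E] ratioTerm
      (truncMarginal c 0 v s E) (36 * (S + 1)) (1000 * (S + 1) ^ 2) := by
  have hget := costs_get (β := β) M hv fun v => encodeTuple (k v) fun i => .num (s v i)
  have hfirst := computes_firstRatio (β := β) M (by omega) (h.fitsIn_value v hv) (hs v).pos.ne'
  have hv₂ := h.succ_sq_le hv
  exact (Computes.split_cons (.var rfl) (.split_cons (.var rfl) (.split_cons (.var rfl)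
    (.bind (.call rfl (.cons (.var rfl) (.var rfl)) hget) (.split_nil (.var rfl)
      (.call rfl (.var rfl) hfirst)))))).mono (by omega) (by nlinarith)

theorem computes_ratio_of_extract_eq_none (M : CostModel w K) (l : ℕ)
    (h : InputFits w K S n k s E) (hs : IsFib c s) (hv : v < n) (hk : degree E v + 1 < k v)
    (hext : extract v E = none) :
    Computes w K (functions β) [encodeRatioInput n (l + 1) v k s E] ratioTerm
      (truncMarginal c (l + 1) v s E) (36 * (S + 1)) (1000 * (S + 1) ^ 2) := by
  have hget := costs_get (β := β) M hv fun v => encodeTuple (k v) fun i => .num (s v i)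
  have hfirst := computes_firstRatio (β := β) M (by omega) (h.fitsIn_value v hv) (hs v).pos.ne'
  have hextract := costs_extract (β := β) M (hv.le.trans h.vertices_le) h.ends_le
  rw [hext] at hextract
  rw [truncMarginal, hext]
  have hv₂ := h.succ_sq_le hv
  have hS := Nat.mul_le_mul_left (8 * S + 70) (Nat.succ_le_succ h.edges_le)
  exact (Computes.split_cons (.var rfl) (.split_cons (.var rfl) (.split_cons (.var rfl)
    (.bind (.call rfl (.cons (.var rfl) (.var rfl)) hget) (.split_cons (.var rfl)
      (.split_nil (.call rfl (.cons (.var rfl) (.var rfl)) hextract)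
        (.call rfl (.var rfl) hfirst))))))).mono (by omega) (by nlinarith)

theorem computes_ratio_of_extract_eq_some (M : CostModel w K) {l X Y : ℕ}
    (h : InputFits w K S n k s E) (hc : 0 < c) (hs : IsFib c s) (hv : v < n)
    (hk : degree E v + 1 < k v) (hext : extract v E = some (u, y, E')) (hSY : S < Y)
    (hX : (S + 1) ^ 2 ≤ X) (hYX : Y ≤ X)
    (ha : Computes w K (functions β) [encodeRatioInput n l v k s E'] ratioTerm
      (truncMarginal c l v s E') Y X)
    (hr : Computes w K (functions β) [encodeRatioInput n l u k s E'] ratioTerm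
      (truncMarginal c l u s E') Y X)
    (hb : Computes w K (functions β) [encodeRatioInput n l v (dropAt u k) (shift u s) E'] ratioTerm
      (truncMarginal c l v (shift u s) E') Y X) :
    Computes w K (functions β) [encodeRatioInput n (l + 1) v k s E] ratioTerm
      (truncMarginal c (l + 1) v s E) (36 * Y) (1000 * X) := by
  obtain ⟨hun, hy, hE'⟩ := admissible_of_extract h.admissible hext
  have hpos {x : ℕ} {s : State} (hs : IsFib c s) : 0 < truncMarginal c l x s E' :=
    truncMarginal_pos hc l x hs fun e he => (hE' e he).le_weight
  have hden : 1 + y * truncMarginal c l u s E' * truncMarginal c l v (shift u s) E' ≠ 0 := by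
    have := hpos (x := u) hs
    have := hpos (x := v) (hs.shift hc u)
    positivity
  have hk₂ : 2 < k v := by
    have := degree_of_extract_eq_some hext v
    rw [if_pos rfl] at this
    omega
  have hstep := computes_step (β := β) M hk₂ hSY (h.fitsIn_value v hv) (h.of_extract hext).2
    ha.fitsIn hb.fitsIn hr.fitsIn ((hs v).recurrence 0) ((hs v).succ hc).pos.ne' hden
  have hget := costs_get (β := β) M hv fun v => encodeTuple (k v) fun i => .num (s v i)
  have htail := costs_tail (β := β) M hun k s
  have hextract := costs_extract (β := β) M (hv.le.trans h.vertices_le) h.ends_le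
  rw [hext] at hextract
  rw [truncMarginal, hext]
  have hv₂ := h.succ_sq_le hv
  have hu₂ := h.succ_sq_le hun
  have hS := Nat.mul_le_mul_left (8 * S + 70) (Nat.succ_le_succ h.edges_le)
  refine (Computes.split_cons (.var rfl) (.split_cons (.var rfl) (.split_cons (.var rfl)
    (.bind (.call rfl (.cons (.var rfl) (.var rfl)) hget) (.split_cons (.var rfl)
      (.split_cons (.call rfl (.cons (.var rfl) (.var rfl)) hextract) (.split_cons (.var rfl)
        (.call rfl (.cons (.var rfl) (.cons (.var rfl) (.cons
          (.call rfl (.cons (.var rfl) (.cons (.var rfl) (.cons (.var rfl) (.var rfl)))) ha.costs)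
          (.cons
            (.call rfl (.cons (.var rfl) (.cons (.var rfl) (.cons (.var rfl) (.var rfl)))) hr.costs)
            (.call rfl (.cons (.var rfl) (.cons (.var rfl) (.cons
              (.call rfl (.cons (.var rfl) (.var rfl)) htail) (.var rfl)))) hb.costs)))))
          hstep)))))))).mono le_rfl ?_
  nlinarith

theorem computes_ratio (M : CostModel w K) (l : ℕ) (h : InputFits w K S n k s E) (hc : 0 < c)
    (hs : IsFib c s) (hv : v < n) (hk : degree E v + 1 < k v) :
    Computes w K (functions β) [encodeRatioInput n l v k s E] ratioTerm
      (truncMarginal c l v s E) (36 ^ (l + 1) * (S + 1)) (1000 ^ (l + 1) * (S + 1) ^ 2) := by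
  induction l generalizing v k s E with
  | zero => simpa only [zero_add, pow_one] using computes_ratio_zero M h hs hv hk
  | succ l ih =>
    have hY : S + 1 ≤ 36 ^ (l + 1) * (S + 1) := Nat.le_mul_of_pos_left _ (by positivity)
    have hX : (S + 1) ^ 2 ≤ 1000 ^ (l + 1) * (S + 1) ^ 2 :=
      Nat.le_mul_of_pos_left _ (by positivity)
    have hYX : 36 ^ (l + 1) * (S + 1) ≤ 1000 ^ (l + 1) * (S + 1) ^ 2 :=
      Nat.mul_le_mul (Nat.pow_le_pow_left (by norm_num) _) (Nat.le_self_pow two_ne_zero _)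
    rw [pow_succ' 36, mul_assoc 36, pow_succ' 1000, mul_assoc 1000]
    rcases hext : extract v E with _ | ⟨u, y, E'⟩
    · exact (computes_ratio_of_extract_eq_none M l h hs hv hk hext).mono
        (Nat.mul_le_mul_left _ hY) (Nat.mul_le_mul_left _ hX)
    · have hu := (admissible_of_extract h.admissible hext).1
      have hE' := (h.of_extract hext).1
      have hdeg_v := degree_of_extract_eq_some hext v
      have hdeg_u := degree_of_extract_eq_some hext u
      have hk_u := h.degree_lt u hu
      have hk_u' : degree E' u + 1 < k u := by grind
      have hk_v' : degree E' v + 1 < dropAt u k v := by grind [dropAt]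
      exact computes_ratio_of_extract_eq_some M h hc hs hv hk hext hY hX hYX
        (ih hE' hs hv (by omega)) (ih hE' hs hu hk_u')
        (ih (hE'.shift hk_u') (hs.shift hc u) hv hk_v')

end Ratio

/-! ### Cost of the truncated partition function -/

section Approx

variable {w : ℝ → ℕ} {K : Subfield ℝ} {β : ℚ} {n S : ℕ} {k : ℕ → ℕ} {s : State} {E : List Edge}
  {c : ℝ}

theorem computes_count (M : CostModel w K) (E : List Edge) :
    Computes w K (functions β) [encodeEdges E] countTerm (E.length + 1) (E.length + 2)
      (10 * (E.length + 1) ^ 2) := by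
  have hfits (E : List Edge) : FitsIn w K (E.length + 2) ((E.length : ℝ) + 1) := by
    exact_mod_cast M.fitsIn_natCast (E.length + 1)
  refine ⟨?_, hfits E⟩
  induction E with
  | nil => exact (Costs.split_nil (.var rfl) (by simpa using .one)).mono (by norm_num)
  | cons e E ih =>
    have h := (hfits (e :: E)).le
    rw [List.length_cons, Nat.cast_succ, add_comm _ (1 : ℝ)] at h ⊢
    exact (Costs.split_cons (.var rfl) (.add .one (.call rfl (.var rfl) ih))).mono
      (by linarith [sq (E.length + 1), sq (E.length + 1 + 1), M.fitsIn_one.le, (hfits E).le])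

theorem computes_heads (M : CostModel w K) (hk : ∀ v < n, 0 < k v)
    (hs : ∀ v < n, FitsIn w K S (s v 0)) :
    Computes w K (functions β) [encodeState n k s] headsTerm (∏ v ∈ Finset.range n, s v 0)
      (S * n + 2) ((n + 1) * (2 * S * n + 20)) := by
  induction n generalizing k s with
  | zero =>
    exact (Computes.split_nil (.var rfl) (by simpa using M.computes_one)).mono (by omega) (by omega)
  | succ n ih =>
    obtain ⟨m, hm⟩ := Nat.exists_eq_add_one_of_ne_zero (hk 0 n.succ_pos).ne'
    have hrec := ih (fun v hv => hk (v + 1) (by omega)) (fun v hv => hs (v + 1) (by omega))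
    rw [Finset.prod_range_succ', mul_comm, encodeState, encodeTuple, hm]
    have hmul {env : List Val} (h₀ : env[0]? = some (.num (s 0 0)))
        (h₃ : env[3]? = some (encodeState n (fun v => k (v + 1)) fun v => s (v + 1))) :=
      M.computes_mul (.var h₀ (hs 0 n.succ_pos)) (.call (i := headsIndex) rfl (.var h₃) hrec)
    exact (Computes.split_cons (.var rfl) (.split_cons (.var rfl) (hmul rfl rfl))).mono
      (by linarith) (by nlinarith)

theorem computes_approx_cons (M : CostModel w K) (l : ℕ) {e : Edge} {R T : ℕ}
    (h : InputFits w K S n k s (e :: E)) (hc : 0 < c) (hs : IsFib c s)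
    (ih : Computes w K (functions β)
      [.cons (encodeFuel l) (.cons (encodeState n k s) (encodeEdges E))] approxTerm
      (approxPartition n c l s E) R T) :
    Computes w K (functions β)
      [.cons (encodeFuel l) (.cons (encodeState n k s) (encodeEdges (e :: E)))] approxTerm
      (approxPartition n c l s (e :: E)) (R + 11 * (36 ^ (l + 1) * (S + 1)))
      (T + 2 * R + 150 * (1000 ^ (l + 1) * (S + 1) ^ 2)) := by
  have hext : extract e.left (e :: E) = some (e.right, e.weight, E) := by simp [extract]
  obtain ⟨he, -⟩ := List.forall_mem_cons.1 h.admissible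
  obtain ⟨hE, hw⟩ := h.of_extract hext
  have hdeg := degree_of_extract_eq_some hext
  have hlt_left := h.degree_lt _ he.left_lt
  have hlt_right := h.degree_lt _ he.right_lt
  have hk_right : degree E e.right + 1 < k e.right := by grind
  have hk_left : degree E e.left + 1 < dropAt e.right k e.left := by grind [dropAt]
  have hright := computes_ratio (β := β) M l hE hc hs he.right_lt hk_right
  have hleft := computes_ratio (β := β) M l (hE.shift hk_right) hc (hs.shift hc e.right) he.left_lt
    hk_left
  have htail := costs_tail (β := β) M he.right_lt k s
  rw [encodeRatioInput] at hright hleft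
  have hmul {env : List Val} (h₀ : env[0]? = some (.num e.left))
      (h₁ : env[1]? = some (.num e.right)) (h₃ : env[3]? = some (.num e.weight))
      (h₅ : env[5]? = some (encodeEdges E)) (h₆ : env[6]? = some (encodeState n k s))
      (h₈ : env[8]? = some (encodeFuel l)) :=
    M.computes_mul (.call (i := approxIndex) rfl (.cons (.var h₈) (.cons (.var h₆) (.var h₅))) ih)
      (M.computes_add M.computes_one (M.computes_mul (.var h₃ hw) (M.computes_mul
        (.call (i := ratioIndex) rfl
          (.cons (.var h₈) (.cons (.var h₁) (.cons (.var h₆) (.var h₅)))) hright)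
        (.call (i := ratioIndex) rfl (.cons (.var h₈) (.cons (.var h₀) (.cons
          (.call (f := tailIndex) rfl (.cons (.var h₁) (.var h₆)) htail) (.var h₅)))) hleft))))
  have hu₂ := h.succ_sq_le he.right_lt
  have hX : (S + 1) ^ 2 ≤ 1000 ^ (l + 1) * (S + 1) ^ 2 := Nat.le_mul_of_pos_left _ (by positivity)
  have hY : S + 1 ≤ 36 ^ (l + 1) * (S + 1) := Nat.le_mul_of_pos_left _ (by positivity)
  have hYX : 36 ^ (l + 1) * (S + 1) ≤ 1000 ^ (l + 1) * (S + 1) ^ 2 :=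
    Nat.mul_le_mul (Nat.pow_le_pow_left (by norm_num) _) (Nat.le_self_pow two_ne_zero _)
  exact (Computes.split_cons (.var rfl) (.split_cons (.var rfl) (.split_cons (.var rfl)
    (.split_cons (.var rfl) (.split_cons (.var rfl) (hmul rfl rfl rfl rfl rfl rfl)))))).mono
      (by linarith) (by nlinarith)

theorem computes_approx (M : CostModel w K) (l : ℕ) (h : InputFits w K S n k s E) (hc : 0 < c)
    (hs : IsFib c s) :
    Computes w K (functions β) [.cons (encodeFuel l) (.cons (encodeState n k s) (encodeEdges E))]
      approxTerm (approxPartition n c l s E)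
      (S * n + 2 + 11 * (36 ^ (l + 1) * (S + 1)) * E.length)
      ((E.length + 1) * (200 * (1000 ^ (l + 1) * (S + 1) ^ 3))) := by
  have hn := h.vertices_le
  induction E with
  | nil =>
    have hk : ∀ v < n, 0 < k v := fun v hv => (Nat.zero_le _).trans_lt (h.degree_lt v hv)
    have hheads := computes_heads (β := β) M hk fun v hv => h.fitsIn_value v hv 0 (hk v hv)
    have hX : (S + 1) ^ 3 ≤ 1000 ^ (l + 1) * (S + 1) ^ 3 :=
      Nat.le_mul_of_pos_left _ (by positivity)
    have hheads_le : (n + 1) * (2 * S * n + 20) ≤ (S + 1) * (2 * S * S + 20) := by gcongr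
    refine (Computes.split_cons (.var rfl) (.split_cons (.var rfl) (.split_nil (.var rfl)
      (.call rfl (.var rfl) hheads)))).mono (by simp) ?_
    rw [List.length_nil]
    nlinarith [S.zero_le, Nat.zero_le (S ^ 2), Nat.zero_le (S ^ 3)]
  | cons e E ih =>
    have hE := (h.of_extract (v := e.left) (u := e.right) (y := e.weight) (E' := E)
      (by simp [extract])).1
    have hlen : E.length ≤ S := hE.edges_le
    have hY : 36 ^ (l + 1) * (S + 1) * E.length ≤ 1000 ^ (l + 1) * (S + 1) ^ 2 := by
      rw [sq, ← mul_assoc]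
      gcongr <;> omega
    have hX : (S + 1) ^ 2 ≤ 1000 ^ (l + 1) * (S + 1) ^ 2 :=
      Nat.le_mul_of_pos_left _ (by positivity)
    have hX₃ : 1000 ^ (l + 1) * (S + 1) ^ 2 ≤ 1000 ^ (l + 1) * (S + 1) ^ 3 := by
      gcongr <;> omega
    have hSn : S * n ≤ S * S := Nat.mul_le_mul_left S hn
    refine (computes_approx_cons M l h hc hs (ih hE)).mono ?_ ?_ <;> rw [List.length_cons]
    · linarith
    · nlinarith

theorem costs_fuel (M : CostModel w K) (l : ℕ) {y : ℝ} (hy : FitsIn w K S y)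
    (hlt : ∀ i < l, y * (β : ℝ) ^ i < 1) (hle : 1 ≤ y * (β : ℝ) ^ l) :
    Costs w (functions β) [.num y] (fuelTerm β) (encodeFuel l)
      ((l + 1) * (4 * S + 4 * bitLength β * l + 20)) := by
  induction l generalizing y S with
  | zero =>
    exact (Costs.ifLe_true .one (.var rfl) (by simpa using hle) .nil).mono
      (by linarith [M.fitsIn_one.le, hy.le])
  | succ l ih =>
    have hyβ := M.fitsIn_mul hy (M.fitsIn_ratCast β)
    have hrec := ih hyβ (fun i hi => by simpa [pow_succ', mul_assoc] using hlt (i + 1) (by omega))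
      (by simpa [pow_succ', mul_assoc] using hle)
    have hlt₀ : ¬ 1 ≤ y := by simpa using hlt 0 l.succ_pos
    exact (Costs.ifLe_false .one (.var rfl) hlt₀ (.cons .nil
      (.call rfl (.mul (.var rfl) (.const β)) hrec))).mono
      (by nlinarith [M.fitsIn_one.le, hy.le, (M.fitsIn_ratCast β).le, hyβ.le])

end Approx

/-! ### Cost of the program -/

/-- A bound for the cost of `program β` at recursion depth `l` on inputs of size `S`. -/
noncomputable def runCost (β : ℚ) (l S : ℕ) : ℕ :=
  (500 + 4 * bitLength β) * 1000 ^ (l + 1) * (S + 1) ^ 4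

section Program

variable {w : ℝ → ℕ} {K : Subfield ℝ} {β : ℚ} {n S : ℕ} {k : ℕ → ℕ} {s : State} {E : List Edge}
  {c ε : ℝ}

theorem CostModel.fitsIn_inv_twentyTwo (M : CostModel w K) : FitsIn w K 6 ((1 / 22 : ℚ) : ℝ) := by
  refine (M.fitsIn_ratCast (1 / 22)).mono ?_
  rw [bitLength_ratCast]
  norm_num
  decide

theorem computes_tolerance (M : CostModel w K) (hε : 0 < ε) (hεS : FitsIn w K S ε)
    (hE : E.length ≤ S) {env : List Val} (henv_edges : env[1]? = some (encodeEdges E))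
    (henv_ε : env[2]? = some (.num ε)) :
    Computes w K (functions β) env toleranceTerm (tolerance ε E.length) (4 * S + 13)
      (10 * (E.length + 1) ^ 2 + 30 * S + 100) := by
  have hden : (E.length : ℝ) + 1 ≠ 0 := by positivity
  have hvar : Computes w K (functions β) env (.var 2) ε S 1 := .var henv_ε hεS
  have h := M.computes_mul ⟨.const (1 / 22), M.fitsIn_inv_twentyTwo⟩
    (M.computes_div (M.computes_div hvar (M.computes_add M.computes_one hvar) (by positivity))
      (.call (i := countIndex) rfl (.var henv_edges) (computes_count M E)) hden)
  norm_num only [Rat.cast_div, Rat.cast_one, Rat.cast_ofNat] at h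
  rw [tolerance]
  exact h.mono (by omega) (by omega)

theorem headsCost_le (hn : n ≤ S) (l : ℕ) :
    (n + 1) * (2 * S * n + 20) + (S * n + 2) + 40 ≤ 70 * (1000 ^ (l + 1) * (S + 1) ^ 4) := by
  have hmono : (n + 1) * (2 * S * n + 20) + (S * n + 2) + 40 ≤
      (S + 1) * (2 * S * S + 20) + (S * S + 2) + 40 := by gcongr
  have hle : (S + 1) ^ 4 ≤ 1000 ^ (l + 1) * (S + 1) ^ 4 :=
    Nat.le_mul_of_pos_left _ (by positivity)
  nlinarith [S.zero_le, Nat.zero_le (S ^ 2), Nat.zero_le (S ^ 3), Nat.zero_le (S ^ 4)]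

theorem toleranceCost_le {m : ℕ} (hm : m ≤ S) (l : ℕ) :
    10 * (m + 1) ^ 2 + 30 * S + 100 ≤ 150 * (1000 ^ (l + 1) * (S + 1) ^ 4) := by
  have hmono : 10 * (m + 1) ^ 2 + 30 * S + 100 ≤ 10 * (S + 1) ^ 2 + 30 * S + 100 := by gcongr
  have hle : (S + 1) ^ 4 ≤ 1000 ^ (l + 1) * (S + 1) ^ 4 :=
    Nat.le_mul_of_pos_left _ (by positivity)
  nlinarith [S.zero_le, Nat.zero_le (S ^ 2), Nat.zero_le (S ^ 3), Nat.zero_le (S ^ 4)]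

theorem fuelCost_le (S B l : ℕ) :
    (l + 1) * (4 * (4 * S + 13) + 4 * B * l + 20) ≤
      (80 + 4 * B) * (1000 ^ (l + 1) * (S + 1) ^ 4) := by
  have hl : (l + 1) * (l + 1) ≤ 1000 ^ (l + 1) := by
    calc (l + 1) * (l + 1) ≤ 2 ^ (l + 1) * 2 ^ (l + 1) := by gcongr <;> exact Nat.lt_two_pow_self.le
      _ = (2 * 2) ^ (l + 1) := (mul_pow _ _ _).symm
      _ ≤ 1000 ^ (l + 1) := Nat.pow_le_pow_left (by norm_num) _
  have hS : S + 1 ≤ (S + 1) ^ 4 := Nat.le_self_pow (by norm_num) _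
  calc (l + 1) * (4 * (4 * S + 13) + 4 * B * l + 20)
      ≤ (l + 1) * ((80 + 4 * B) * ((l + 1) * (S + 1))) := by
        refine Nat.mul_le_mul_left _ ?_
        nlinarith [Nat.zero_le (B * S), Nat.zero_le (B * l * S), Nat.zero_le (l * S)]
    _ = (80 + 4 * B) * ((l + 1) * (l + 1) * (S + 1)) := by ring
    _ ≤ (80 + 4 * B) * (1000 ^ (l + 1) * (S + 1) ^ 4) := by gcongr

theorem costs_program_of_heads_nonpos (M : CostModel w K) (hn : n ≤ S) (hk : ∀ v < n, 0 < k v)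
    (hs : ∀ v < n, FitsIn w K S (s v 0)) (hprod : ∏ v ∈ Finset.range n, s v 0 ≤ 0) :
    Costs w (functions β) [encodeInput ε n k s E] (program β).main (.num 0) (runCost β 0 S) := by
  have hheads := computes_heads (β := β) M hk hs
  have hcost := (headsCost_le hn 0).trans <| Nat.mul_le_mul_right (1000 ^ (0 + 1) * (S + 1) ^ 4)
    (show 70 ≤ 500 + 4 * bitLength β by omega)
  refine (Costs.split_cons (.var rfl) (.split_cons (.var rfl) (.ifLe_true
    (.call rfl (.var rfl) hheads.costs) .zero hprod .zero))).mono ?_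
  rw [runCost, mul_assoc (500 + 4 * bitLength β)]
  linarith [hheads.fitsIn.le, M.fitsIn_zero.le]

theorem costs_program_of_heads_pos (M : CostModel w K) (l : ℕ) (h : InputFits w K S n k s E)
    (hc : 0 < c) (hs : IsFib c s) (hε : 0 < ε) (hεS : FitsIn w K S ε)
    (hlt : ∀ i < l, tolerance ε E.length * (β : ℝ) ^ i < 1)
    (hle : 1 ≤ tolerance ε E.length * (β : ℝ) ^ l) :
    Costs w (functions β) [encodeInput ε n k s E] (program β).main
      (.num (approxPartition n c l s E)) (runCost β l S) := by
  have hk : ∀ v < n, 0 < k v := fun v hv => (Nat.zero_le _).trans_lt (h.degree_lt v hv)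
  have hheads := computes_heads (β := β) M hk fun v hv => h.fitsIn_value v hv 0 (hk v hv)
  have hprod : ¬ ∏ v ∈ Finset.range n, s v 0 ≤ 0 :=
    not_le.2 (Finset.prod_pos fun v _ => (hs v).pos)
  have happrox := computes_approx (β := β) M l h hc hs
  have htol {env : List Val} := computes_tolerance (β := β) (env := env) M hε hεS h.edges_le
  have htol_fits := (htol (env := [encodeState n k s, encodeEdges E, .num ε]) rfl rfl).fitsIn
  have hfuel := costs_fuel M l htol_fits hlt hle
  have happrox_le : (E.length + 1) * (200 * (1000 ^ (l + 1) * (S + 1) ^ 3)) ≤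
      200 * (1000 ^ (l + 1) * (S + 1) ^ 4) := by
    linarith [Nat.mul_le_mul_right (200 * (1000 ^ (l + 1) * (S + 1) ^ 3))
      (Nat.succ_le_succ h.edges_le)]
  refine (Costs.split_cons (.var rfl) (.split_cons (.var rfl) (.ifLe_false
    (.call rfl (.var rfl) hheads.costs) .zero hprod (.call rfl (.cons
      (.call rfl (htol rfl rfl).costs hfuel) (.cons (.var rfl) (.var rfl)))
        happrox.costs)))).mono ?_
  rw [runCost, mul_assoc (500 + 4 * bitLength β)]
  linarith [hheads.fitsIn.le, M.fitsIn_zero.le, headsCost_le h.vertices_le l,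
    toleranceCost_le h.edges_le l, fuelCost_le S (bitLength β) l]

end Program

/-! ### Holant instances -/

section Extend

variable {c p q : ℝ} {f : List ℝ}

/-- The solution of the Fibonacci recurrence with initial values `a` and `b`. -/
def fibSeq (c a b : ℝ) : ℕ → ℝ
  | 0 => a
  | 1 => b
  | i + 2 => c * fibSeq c a b (i + 1) + fibSeq c a b i

/-- The infinite sequence that continues a Fibonacci function `[f_0, …, f_d]`, with `f_1 = c f_0` if
`d = 0`. -/
noncomputable def extend (c : ℝ) (f : List ℝ) : ℕ → ℝ :=
  fibSeq c (f.headD 0) (f.getD 1 (c * f.headD 0))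

theorem extend_apply (hf : f ∈ fibonacciFamily c p q) {i : ℕ} (hi : i < f.length) :
    extend c f i = f[i] := by
  induction i using Nat.twoStepInduction with
  | zero =>
    cases f with
    | nil => simp at hi
    | cons x f => rfl
  | one => simp [extend, fibSeq, hi]
  | more i ih₀ ih₁ =>
    rw [hf.2.1 i hi, ← ih₀ (by omega), ← ih₁ (by omega)]
    rfl

theorem isFibSeq_extend (hc : 0 < c) (hf : f ∈ fibonacciFamily c (c / 2) (c + 2 / c))
    (hpos : 0 < f.headD 0) : IsFibSeq c (extend c f) := by
  have hratio : c / 2 * extend c f 0 ≤ extend c f 1 ∧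
      extend c f 1 ≤ (c + 2 / c) * extend c f 0 := by
    by_cases hlen : 1 < f.length
    · rw [extend_apply hf hlen, extend_apply hf (by omega)]
      exact hf.2.2 0 hlen
    · have hone : extend c f 1 = c * f.headD 0 := List.getD_eq_default _ _ (by omega)
      rw [hone]
      have h2c : 0 < 2 / c := by positivity
      exact ⟨mul_le_mul_of_nonneg_right (by linarith) hpos.le,
        mul_le_mul_of_nonneg_right (by linarith) hpos.le⟩
  exact ⟨hpos, hratio.1, hratio.2, fun _ => rfl⟩

theorem headD_nonneg (hf : f ∈ fibonacciFamily c p q) : 0 ≤ f.headD 0 := by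
  cases f with
  | nil => exact le_rfl
  | cons x f => exact hf.1 x List.mem_cons_self

theorem eq_zero_of_headD_eq_zero (hf : f ∈ fibonacciFamily c p q) (hzero : f.headD 0 = 0) {i : ℕ}
    (hi : i < f.length) : f[i] = 0 := by
  induction i with
  | zero =>
    cases f with
    | nil => simp at hi
    | cons x f => exact hzero
  | succ i ih =>
    refine le_antisymm ?_ (hf.1 _ (List.getElem_mem hi))
    simpa [ih (by omega)] using (hf.2.2 i hi).2

end Extend

section Instance

variable {w : ℝ → ℕ} {K : Subfield ℝ} {c p q ε : ℝ} {S : ℕ} {Ω : HolantInstance}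

/-- The edges of a graph that is given by end points and weights, as in `HolantInstance`. -/
noncomputable def listEdges {n m : ℕ} (ends : Fin m → Fin n × Fin n) (x : Fin m → ℝ) : List Edge :=
  List.ofFn fun e => ⟨(ends e).1, (ends e).2, x e⟩

/-- The vertex function at `v`, and `[1]` if `Ω` has no vertex `v`. -/
noncomputable def sigAt (Ω : HolantInstance) (v : ℕ) : List ℝ :=
  if h : v < Ω.n then Ω.sig ⟨v, h⟩ else [1]

/-- The vertex functions of an instance, continued to infinite sequences. -/
noncomputable def initialState (c : ℝ) (Ω : HolantInstance) : State := fun v => extend c (sigAt Ω v)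

/-- The number of values of the vertex function at `v`. -/
noncomputable def numValues (Ω : HolantInstance) (v : ℕ) : ℕ := (sigAt Ω v).length

theorem sigAt_coe (Ω : HolantInstance) (v : Fin Ω.n) : sigAt Ω v = Ω.sig v := dif_pos v.2

theorem isFib_initialState (hc : 0 < c) (hΩ : ∀ v, Ω.sig v ∈ fibonacciFamily c (c / 2) (c + 2 / c))
    (hpos : ∀ v, 0 < (Ω.sig v).headD 0) : IsFib c (initialState c Ω) := by
  intro v
  by_cases h : v < Ω.n
  · rw [initialState, sigAt_coe Ω ⟨v, h⟩]
    exact isFibSeq_extend hc (hΩ _) (hpos _)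
  · rw [initialState, sigAt, dif_neg h]
    exact isFibSeq_extend hc (by simp [fibonacciFamily]) (by simp)

theorem initialState_apply (hΩ : ∀ v, Ω.sig v ∈ fibonacciFamily c p q) (v : Fin Ω.n) {i : ℕ}
    (hi : i < (Ω.sig v).length) : initialState c Ω v i = (Ω.sig v)[i] := by
  rw [initialState, sigAt_coe, extend_apply (hΩ v) hi]

theorem shift_shift_apply {n : ℕ} (p : Fin n × Fin n) (s : State) (v : Fin n) (i : ℕ) :
    shift p.1 (shift p.2 s) v i = s v (endsAt p v + i) := by
  simp only [shift, endsAt, ← Fin.ext_iff, eq_comm (a := v)]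
  congr 1
  omega

theorem sum_config_eq_partition {n m : ℕ} (ends : Fin m → Fin n × Fin n) (x : Fin m → ℝ)
    (s : State) :
    ∑ σ : Fin m → Bool, (∏ e, if σ e then x e else 1) *
      ∏ v : Fin n, s v (∑ e, if σ e then endsAt (ends e) v else 0) =
    partition n s (listEdges ends x) := by
  induction m generalizing s with
  | zero => simp [listEdges, partition, Finset.prod_range]
  | succ m ih =>
    rw [listEdges, List.ofFn_succ, partition, ← listEdges, ← ih, ← ih,
      ← (Fin.consEquiv fun _ => Bool).sum_comp, Fintype.sum_prod_type, Fintype.sum_bool,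
      Finset.mul_sum, add_comm]
    congr 1
    · refine Finset.sum_congr rfl fun σ _ => ?_
      simp [Fin.prod_univ_succ, Fin.sum_univ_succ, Fin.consEquiv]
    · refine Finset.sum_congr rfl fun σ _ => ?_
      simp only [Fin.prod_univ_succ, Fin.sum_univ_succ, Fin.consEquiv, Equiv.coe_fn_mk,
        Fin.cons_zero, Fin.cons_succ, if_true, shift_shift_apply]
      ring

theorem partition_initialState (hΩ : ∀ v, Ω.sig v ∈ fibonacciFamily c p q) :
    partition Ω.n (initialState c Ω) (listEdges Ω.ends Ω.weight) = Ω.Z := by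
  rw [← sum_config_eq_partition, HolantInstance.Z]
  refine Finset.sum_congr rfl fun σ _ => ?_
  rw [HolantInstance.configWeight]
  congr 1
  exact Finset.prod_congr rfl fun v _ => initialState_apply hΩ v (Ω.load_lt_length σ v)

theorem Z_eq_zero_of_headD_eq_zero (hΩ : ∀ v, Ω.sig v ∈ fibonacciFamily c p q) {v : Fin Ω.n}
    (hv : (Ω.sig v).headD 0 = 0) : Ω.Z = 0 := by
  refine Finset.sum_eq_zero fun σ _ => ?_
  rw [HolantInstance.configWeight, Finset.prod_eq_zero (Finset.mem_univ v)
    (eq_zero_of_headD_eq_zero (hΩ v) hv (Ω.load_lt_length σ v)), mul_zero]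

theorem degree_listEdges {n m : ℕ} (ends : Fin m → Fin n × Fin n) (x : Fin m → ℝ) (v : Fin n) :
    degree (listEdges ends x) v = ∑ e, endsAt (ends e) v := by
  simp [degree, listEdges, List.map_ofFn, List.sum_ofFn, Edge.endsAt, endsAt, Fin.ext_iff]

theorem encodeTuple_eq_ofList (n : ℕ) (f : ℕ → Val) :
    encodeTuple n f = .ofList (List.ofFn fun i : Fin n => f i) := by
  induction n generalizing f with
  | zero => rfl
  | succ n ih => rw [List.ofFn_succ, encodeTuple, ih, Val.ofList]; rfl

theorem encode_eq_encodeInput (hΩ : ∀ v, Ω.sig v ∈ fibonacciFamily c p q) :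
    Ω.encode ε = encodeInput ε Ω.n (numValues Ω) (initialState c Ω)
      (listEdges Ω.ends Ω.weight) := by
  have hsig (v : Fin Ω.n) : Val.ofList ((Ω.sig v).map .num) =
      encodeTuple (numValues Ω v) fun i => .num (initialState c Ω v i) := by
    rw [encodeTuple_eq_ofList, numValues, sigAt_coe, ← List.ofFn_getElem (xs := Ω.sig v),
      List.map_ofFn, List.ofFn_getElem]
    congr 2
    funext i
    exact congrArg Val.num (initialState_apply hΩ v i.2).symm
  simp only [HolantInstance.encode, hsig]
  rw [encodeInput, encodeState, encodeTuple_eq_ofList, encodeEdges, listEdges, List.map_ofFn]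
  rfl

/-- The numbers in an instance and `ε` are at most of size `S`. -/
structure InstanceFits (w : ℝ → ℕ) (K : Subfield ℝ) (S : ℕ) (Ω : HolantInstance) (ε : ℝ) :
    Prop where
  size_le : Ω.size ≤ S
  fitsIn_epsilon : FitsIn w K S ε
  fitsIn_sig : ∀ v, ∀ x ∈ Ω.sig v, FitsIn w K S x
  fitsIn_weight : ∀ e, FitsIn w K S (Ω.weight e)

theorem length_listEdges {n m : ℕ} (ends : Fin m → Fin n × Fin n) (x : Fin m → ℝ) :
    (listEdges ends x).length = m := List.length_ofFn

theorem admissible_listEdges {lam : ℝ} (hΩ : ∀ e, lam ≤ Ω.weight e) :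
    ∀ e ∈ listEdges Ω.ends Ω.weight, e.Admissible Ω.n lam := by
  intro e he
  obtain ⟨i, rfl⟩ := (List.mem_ofFn' _ _).1 he
  exact ⟨Fin.is_lt _, Fin.is_lt _, hΩ i⟩

theorem numValues_pos (v : Fin Ω.n) : 0 < numValues Ω v := by
  rw [numValues, sigAt_coe, Ω.sig_length]
  omega

theorem InstanceFits.fitsIn_value (h : InstanceFits w K S Ω ε)
    (hΩ : ∀ v, Ω.sig v ∈ fibonacciFamily c p q) (v : Fin Ω.n) {i : ℕ} (hi : i < numValues Ω v) :
    FitsIn w K S (initialState c Ω v i) := by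
  rw [numValues, sigAt_coe] at hi
  rw [initialState_apply hΩ v hi]
  exact h.fitsIn_sig v _ (List.getElem_mem hi)

theorem InstanceFits.inputFits (h : InstanceFits w K S Ω ε)
    (hΩ : Ω.IsInstanceOf (fibonacciFamily c p q) (Set.Ici 0)) :
    InputFits w K S Ω.n (numValues Ω) (initialState c Ω) (listEdges Ω.ends Ω.weight) where
  vertices_le := (Nat.le_add_right _ _).trans h.size_le
  edges_le := (length_listEdges _ _).le.trans ((Nat.le_add_left _ _).trans h.size_le)
  admissible := admissible_listEdges hΩ.2
  fitsIn_weight e he := by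
    obtain ⟨i, rfl⟩ := (List.mem_ofFn' _ _).1 he
    exact h.fitsIn_weight i
  fitsIn_value v hv _ hi := h.fitsIn_value hΩ.1 ⟨v, hv⟩ hi
  degree_lt v hv := by
    have hdegree := degree_listEdges Ω.ends Ω.weight ⟨v, hv⟩
    rw [numValues, sigAt_coe Ω ⟨v, hv⟩, Ω.sig_length]
    exact Nat.lt_succ_of_le hdegree.le

end Instance

/-! ### The approximation scheme -/

section Scheme

variable {β : ℚ} {c lam ε : ℝ} {Ω : HolantInstance}

theorem exists_least_pow {y b : ℝ} (hy : 0 < y) (hy' : y ≤ 1) (hb : 1 < b) :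
    ∃ l : ℕ, (∀ i < l, y * b ^ i < 1) ∧ 1 ≤ y * b ^ l ∧ b ^ l ≤ b / y := by
  classical
  have hex : ∃ l : ℕ, 1 ≤ y * b ^ l := by
    obtain ⟨l, hl⟩ := pow_unbounded_of_one_lt y⁻¹ hb
    exact ⟨l, (inv_le_iff_one_le_mul₀' hy).1 hl.le⟩
  have hlt : ∀ i < Nat.find hex, y * b ^ i < 1 := fun i hi => not_le.1 (Nat.find_min hex hi)
  refine ⟨Nat.find hex, hlt, Nat.find_spec hex, (le_div_iff₀' hy).2 ?_⟩
  cases h : Nat.find hex with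
  | zero => linarith
  | succ l =>
    rw [pow_succ, ← mul_assoc]
    exact mul_le_of_le_one_left (by linarith) (hlt l (by omega)).le

theorem tolerance_pos (hε : 0 < ε) (m : ℕ) : 0 < tolerance ε m := by
  unfold tolerance
  positivity

theorem tolerance_le_one (hε : 0 < ε) (m : ℕ) : tolerance ε m ≤ 1 := by
  have hη : ε / (1 + ε) ≤ 1 := (div_le_one (by positivity)).2 (by linarith)
  have hm : ε / (1 + ε) / (m + 1) ≤ 1 :=
    div_le_one_of_le₀ (hη.trans (le_add_of_nonneg_left m.cast_nonneg)) (by positivity)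
  unfold tolerance
  linarith

theorem div_tolerance (hε : 0 < ε) (b : ℝ) (m : ℕ) :
    b / tolerance ε m = 22 * b * ((m + 1) * (1 + 1 / ε)) := by
  unfold tolerance
  field_simp
  ring

theorem mul_lt_of_le_tolerance {r : ℝ} {m : ℕ} (hε : 0 < ε) (hr : r ≤ tolerance ε m) :
    m * (2 * (r * 11)) < ε / (1 + ε) := by
  have hpos := tolerance_pos hε m
  calc m * (2 * (r * 11)) ≤ m * (22 * tolerance ε m) :=
        mul_le_mul_of_nonneg_left (by linarith) m.cast_nonneg
    _ < (m + 1) * (22 * tolerance ε m) := by gcongr; linarith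
    _ = ε / (1 + ε) := by unfold tolerance; field_simp

theorem approximatesWithin_of_near {δ Z z : ℝ} (hε : 0 < ε) (h : Near δ Z z)
    (hδ : δ < ε / (1 + ε)) : ApproximatesWithin ε Z z := by
  have hinv : (1 + ε)⁻¹ < Real.exp (-δ) := by
    have hlinear := Real.add_one_le_exp (-δ)
    have : (1 + ε)⁻¹ = 1 - ε / (1 + ε) := by field_simp; ring
    linarith
  have hexp : Real.exp δ < 1 + ε := by
    rw [Real.exp_neg] at hinv
    exact (inv_lt_inv₀ (by positivity) (Real.exp_pos δ)).1 hinv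
  have hsub : 1 - ε < Real.exp (-δ) := by
    refine lt_of_le_of_lt ?_ hinv
    rw [← one_div, le_div_iff₀ (by positivity)]
    nlinarith
  refine ⟨fun _ => ⟨?_, ?_⟩, fun h0 => absurd h0 h.pos_left.ne'⟩
  · calc (1 - ε) * Z < Real.exp (-δ) * Z := mul_lt_mul_of_pos_right hsub h.pos_left
      _ ≤ Real.exp (-δ) * (Real.exp δ * z) := by gcongr; exact h.le_left
      _ = z := by rw [← mul_assoc, ← Real.exp_add]; simp
  · exact h.le_right.trans_lt (mul_lt_mul_of_pos_right hexp h.pos_left)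

theorem pow_le_of_one_le_mul_pow {r b y : ℝ} {l : ℕ} (hr : 0 < r) (hb : 0 ≤ b) (hbr : b ≤ r⁻¹)
    (hy : 0 ≤ y) (hle : 1 ≤ y * b ^ l) : r ^ l ≤ y := by
  have hrb : r * b ≤ 1 := (mul_le_mul_of_nonneg_left hbr hr.le).trans (mul_inv_cancel₀ hr.ne').le
  calc r ^ l ≤ r ^ l * (y * b ^ l) := le_mul_of_one_le_right (by positivity) hle
    _ = y * (r * b) ^ l := by ring
    _ ≤ y := mul_le_of_le_one_right hy (pow_le_one₀ (by positivity) hrb)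

/-- At some depth `l`, logarithmic in the number of edges and in `1 / ε`, `program β` computes an
approximation of `Z` within `ε`, at a cost bounded in terms of `l`. -/
def Approximates (β : ℚ) (Ω : HolantInstance) (ε : ℝ) : Prop :=
  ∃ z, ApproximatesWithin ε Ω.Z z ∧ ∃ l : ℕ, (β : ℝ) ^ l ≤ β / tolerance ε Ω.m ∧
    ∀ {w : ℝ → ℕ} {K : Subfield ℝ} {S : ℕ}, CostModel w K → InstanceFits w K S Ω ε →
      Costs w (functions β) [Ω.encode ε] (program β).main (.num z) (runCost β l S)

theorem approximates_of_heads_pos (hlam : 0 < lam) (hc : 2.57 ≤ c) (hβ : 1 < β)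
    (hrate : (β : ℝ) ≤ (rate (lam * c ^ 2))⁻¹)
    (hΩ : Ω.IsInstanceOf (fibonacciFamily c (c / 2) (c + 2 / c)) (Set.Ici lam)) (hε : 0 < ε)
    (hpos : ∀ v, 0 < (Ω.sig v).headD 0) : Approximates β Ω ε := by
  have hc0 : 0 < c := by linarith
  have hs := isFib_initialState hc0 hΩ.1 hpos
  obtain ⟨l, hlt, hle, hl⟩ := exists_least_pow (b := β) (tolerance_pos hε Ω.m)
    (tolerance_le_one hε Ω.m) (by exact_mod_cast hβ)
  have hr := rate_pos (k := lam * c ^ 2) (by positivity)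
  have hβ' : (0 : ℝ) < β := by exact_mod_cast zero_lt_one.trans hβ
  have hnear := near_approxPartition hc hlam.le l hs (admissible_listEdges hΩ.2)
  rw [partition_initialState hΩ.1, length_listEdges] at hnear
  refine ⟨_, approximatesWithin_of_near hε hnear (mul_lt_of_le_tolerance hε
    (pow_le_of_one_le_mul_pow hr hβ'.le hrate (tolerance_pos hε _).le hle)), l, hl, fun M h => ?_⟩
  rw [encode_eq_encodeInput hΩ.1]
  have hfits := h.inputFits ⟨hΩ.1, fun e => hlam.le.trans (hΩ.2 e)⟩
  exact costs_program_of_heads_pos M l hfits hc0 hs hε h.fitsIn_epsilon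
    (by rwa [length_listEdges]) (by rwa [length_listEdges])

theorem approximates_of_head_eq_zero {p q : ℝ} (hβ : 1 < β)
    (hΩ : ∀ v, Ω.sig v ∈ fibonacciFamily c p q) (hε : 0 < ε) {v : Fin Ω.n}
    (hzero : (Ω.sig v).headD 0 = 0) : Approximates β Ω ε := by
  have hβ' : (1 : ℝ) ≤ β := by exact_mod_cast hβ.le
  have hhead : initialState c Ω v 0 = 0 := by
    rw [initialState, sigAt_coe]
    exact hzero
  refine ⟨0, ⟨fun h => absurd (Z_eq_zero_of_headD_eq_zero hΩ hzero) h, fun _ => rfl⟩, 0, ?_,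
    fun M h => ?_⟩
  · rw [pow_zero, one_le_div (tolerance_pos hε _)]
    exact (tolerance_le_one hε _).trans hβ'
  · rw [encode_eq_encodeInput hΩ]
    exact costs_program_of_heads_nonpos M ((Nat.le_add_right _ _).trans h.size_le)
      (fun v hv => numValues_pos ⟨v, hv⟩)
      (fun v hv => h.fitsIn_value hΩ ⟨v, hv⟩ (numValues_pos ⟨v, hv⟩))
      (Finset.prod_eq_zero (Finset.mem_range.2 v.2) hhead).le

theorem approximates (hlam : 0 < lam) (hc : 2.57 ≤ c) (hβ : 1 < β)
    (hrate : (β : ℝ) ≤ (rate (lam * c ^ 2))⁻¹)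
    (hΩ : Ω.IsInstanceOf (fibonacciFamily c (c / 2) (c + 2 / c)) (Set.Ici lam)) (hε : 0 < ε) :
    Approximates β Ω ε := by
  by_cases hpos : ∀ v, 0 < (Ω.sig v).headD 0
  · exact approximates_of_heads_pos hlam hc hβ hrate hΩ hε hpos
  · push Not at hpos
    obtain ⟨v, hv⟩ := hpos
    exact approximates_of_head_eq_zero hβ hΩ.1 hε (hv.antisymm (headD_nonneg (hΩ.1 v)))

theorem runCost_le {j l m S : ℕ} (hj : 1000 ≤ (β : ℝ) ^ j) (hβ : 1 < β) (hε : 0 < ε) (hm : m ≤ S)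
    (hl : (β : ℝ) ^ l ≤ β / tolerance ε m) :
    (runCost β l S : ℝ) ≤
      (500 + 4 * bitLength β) * 1000 * (22 * β) ^ j * (S + 1 / ε + 1) ^ (2 * j + 4) := by
  have hβ' : (1 : ℝ) < β := by exact_mod_cast hβ
  have hm' : (m : ℝ) ≤ S := by exact_mod_cast hm
  have hS : (0 : ℝ) ≤ S := S.cast_nonneg
  have hinv : 0 < 1 / ε := by positivity
  set W : ℝ := S + 1 / ε + 1
  have hbase : (β : ℝ) ^ l ≤ 22 * β * W ^ 2 := by
    rw [div_tolerance hε] at hl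
    refine hl.trans (mul_le_mul_of_nonneg_left ?_ (by positivity))
    rw [sq]
    exact mul_le_mul (by linarith) (by linarith) (by positivity) (by positivity)
  have hpow : (1000 : ℝ) ^ l ≤ (22 * β) ^ j * W ^ (2 * j) := by
    calc (1000 : ℝ) ^ l ≤ ((β : ℝ) ^ j) ^ l := pow_le_pow_left₀ (by norm_num) hj l
      _ = ((β : ℝ) ^ l) ^ j := pow_right_comm _ _ _
      _ ≤ (22 * β * W ^ 2) ^ j := pow_le_pow_left₀ (by positivity) hbase j
      _ = (22 * β) ^ j * W ^ (2 * j) := by rw [mul_pow, pow_mul]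
  calc (runCost β l S : ℝ)
      = (500 + 4 * bitLength β) * 1000 * 1000 ^ l * (S + 1) ^ 4 := by
        rw [runCost]
        push_cast
        ring
    _ ≤ (500 + 4 * bitLength β) * 1000 * ((22 * β) ^ j * W ^ (2 * j)) * W ^ 4 := by
        gcongr
        linarith
    _ = _ := by ring

theorem exists_runCost_le (hβ : 1 < β) :
    ∃ C k : ℕ, ∀ {l m S : ℕ} {ε : ℝ}, 0 < ε → m ≤ S → (β : ℝ) ^ l ≤ β / tolerance ε m →
      (runCost β l S : ℝ) ≤ C * (S + 1 / ε + 1) ^ k := by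
  obtain ⟨j, hj⟩ := pow_unbounded_of_one_lt 1000 (show (1 : ℝ) < β by exact_mod_cast hβ)
  obtain ⟨C, hC⟩ := exists_nat_ge ((500 + 4 * bitLength β) * 1000 * (22 * β) ^ j : ℝ)
  refine ⟨C, 2 * j + 4, fun hε hm hl => (runCost_le hj.le hβ hε hm hl).trans ?_⟩
  gcongr

theorem instanceFits_unitCost (Ω : HolantInstance) (ε : ℝ) :
    InstanceFits unitCost ⊤ Ω.size Ω ε where
  size_le := le_rfl
  fitsIn_epsilon := ⟨trivial, Nat.zero_le _⟩
  fitsIn_sig _ _ _ := ⟨trivial, Nat.zero_le _⟩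
  fitsIn_weight _ := ⟨trivial, Nat.zero_le _⟩

theorem bitLength_sig_le (Ω : HolantInstance) (v : Fin Ω.n) {x : ℝ} (hx : x ∈ Ω.sig v) :
    bitLength x ≤ Ω.bitSize := by
  have hvalue : bitLength x ≤ ((Ω.sig v).map bitLength).sum :=
    List.single_le_sum (by simp) _ (List.mem_map_of_mem hx)
  have hvertex := Finset.single_le_sum (f := fun v => ((Ω.sig v).map bitLength).sum)
    (fun _ _ => Nat.zero_le _) (Finset.mem_univ v)
  unfold HolantInstance.bitSize
  omega

theorem bitLength_weight_le (Ω : HolantInstance) (e : Fin Ω.m) :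
    bitLength (Ω.weight e) ≤ Ω.bitSize := by
  have hedge := Finset.single_le_sum (f := fun e => bitLength (Ω.weight e))
    (fun _ _ => Nat.zero_le _) (Finset.mem_univ e)
  unfold HolantInstance.bitSize
  omega

theorem instanceFits_bitLength (hΩ : Ω.IsRational) (hε : IsRat ε) :
    InstanceFits bitLength (Rat.castHom ℝ).fieldRange (Ω.bitSize + bitLength ε) Ω ε where
  size_le := by
    unfold HolantInstance.bitSize
    omega
  fitsIn_epsilon := ⟨hε, Nat.le_add_left _ _⟩
  fitsIn_sig v x hx := ⟨hΩ.1 v x hx, (bitLength_sig_le Ω v hx).trans (Nat.le_add_right _ _)⟩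
  fitsIn_weight e := ⟨hΩ.2 e, (bitLength_weight_le Ω e).trans (Nat.le_add_right _ _)⟩

end Scheme

end FibHolant

open FibHolant in
theorem theorem3 (lam c : ℝ) (hlam : 0 < lam) (hc : 2.57 ≤ c) :
    HasFPTAS (fibonacciFamily c (c / 2) (c + 2 / c)) (Set.Ici lam) := by
  have hk : 0 < lam * c ^ 2 := by
    have : 0 < c := by linarith
    positivity
  obtain ⟨β, hβ, hrate⟩ :=
    exists_rat_btwn (one_lt_inv_iff₀.2 ⟨rate_pos hk.le, rate_lt_one hk⟩)
  replace hβ : 1 < β := by exact_mod_cast hβ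
  obtain ⟨C, k, hCk⟩ := exists_runCost_le hβ
  refine ⟨program β, C, k, fun Ω hΩ ε hε => ?_⟩
  obtain ⟨z, hz, l, hl, hcosts⟩ := approximates hlam hc hβ hrate.le hΩ hε
  have run {w : ℝ → ℕ} {K : Subfield ℝ} {S : ℕ} (M : CostModel w K)
      (h : InstanceFits w K S Ω ε) : ∃ t, (program β).Run w (Ω.encode ε) (.num z) t ∧
        (t : ℝ) ≤ C * (S + 1 / ε + 1) ^ k := by
    obtain ⟨t, ht, hle⟩ := hcosts M h
    have hm : Ω.m ≤ S := (Nat.le_add_left _ _).trans h.size_le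
    exact ⟨t, ht, (Nat.cast_le.2 hle).trans (hCk hε hm hl)⟩
  refine ⟨z, hz, run costModel_unitCost (instanceFits_unitCost Ω ε), fun hrat hεrat => ?_⟩
  exact_mod_cast run costModel_bitLength (instanceFits_bitLength hrat hεrat)
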